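/- Let $r,l,d\ge 0$ be integers and let $P=\{p_{ij}\colon\mathbb Z^d\to\mathbb Z : 1\le i\le r,\ 1\le j\le l\}$ be a family of integer-valued polynomials that is an ED-set, i.e.: (1) no $p_{ij}$ is a nonzero constant; (2) no two members of $P$ differ by a nonzero constant; (3) for every $i$ there is $j$ with $p_{ij}\ne 0$; (4) for all $i_1\neq i_2$ there is $j$ with $p_{i_1j}\ne p_{i_2j}$. Then there is an integer $k\ge 1$, depending only on $P$, such that the following holds for every probability space $(X,\mathcal B,\mu)$ with commuting invertible measure preserving transformations $T_1,\dots,T_l$ for which $T_1^{c_1}\cdots T_l^{c_l}$ is ergodic for every $(c_1,\dots,c_l)\in\mathbb Z^l\setminus\{0\}$ (a freely generated totally ergodic system). For an ergodic $T$ let $\mu_T^{[0]}=\mu$, let $\mu_T^{[n+1]}$ be the relatively independent square of $\mu_T^{[n]}$ over the $\sigma$-algebra of $T\times\cdots\times T$-invariant subsets of $X^{2^n}$ (these measures exist, for instance, on every standard Borel space), and let $|||f|||_{n,T}\ge 0$ be given by $|||f|||_{n,T}^{2^n}=\int_{X^{2^n}}\prod_{\epsilon}f(x_\epsilon)\,d\mu_T^{[n]}$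 for real-valued $f\in L^\infty(\mu)$ and $n\ge1$. For $n\ge 0$ let $\mathcal Z_n(X,T)$ be the $T$-invariant sub-$\sigma$-algebra (unique up to null sets) such that, for $f\in L^\infty(\mu)$, $\mathbb E(f\mid\mathcal Z_n(X,T))=0$ if and only if $|||f|||_{n+1,T}=0$. (a) If $f_1,\dots,f_r\in L^\infty(\mu)$ are real-valued and $|||f_m|||_{k,T_j}=0$ for some $1\le m\le r$ and some $1\le j\le l$ (the measure $\mu_{T_j}^{[k]}$ being defined), then for every Følner sequence $(\Phi_N)$ of nonempty finite subsets of $\mathbb Z^d$ $$\lim_{N\to\infty}\Big\|\frac1{|\Phi_N|}\sum_{u\in\Phi_N}\prod_{i=1}^r f_i\big(T_1^{p_{i1}(u)}\cdots T_l^{p_{il}(u)}x\big)\Big\|_{L^2(\mu)}=0 .$$ (b) Equivalently, for every $1\le j\le l$, $\mathcal Z_{k-1}(X,T_j)$ is a characteristic factor for these averages: it is invariant (up to null sets) under $T_1,\dots,T_l$, and the averages tend to $0$ in $L^2(\mu)$ along every Følner sequence in $\mathbb Z^d$ whenever $f_1,\dots,f_r\in L^\infty(\mu)$ and $\mathbb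 E(f_i\mid\mathcal Z_{k-1}(X,T_j))=0$ for some $i$. -/

import Mathlib

open MeasureTheory ProbabilityTheory Filter Topology
open scoped ENNReal

noncomputable section

namespace PolyErgodic

/-! ### Systems of commuting transformations -/

/-- The transformation `T₁ ^ c₁ ⋯ T_l ^ c_l` (composition of integer powers, in this order). -/
def monomialMap {X : Type*} {l : ℕ} (T : Fin l → Equiv.Perm X) (c : Fin l → ℤ) : Equiv.Perm X :=
  (List.ofFn fun j => T j ^ c j).prod

/-- `T₁, …, T_l` are commuting invertible measure preserving transformations of `(X, μ)`. -/
structure IsSystem {X : Type*} [MeasurableSpace X] {l : ℕ} (μ : Measure X)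
    (T : Fin l → Equiv.Perm X) : Prop where
  measurePreserving : ∀ j, MeasurePreserving (T j) μ μ
  measurable_symm : ∀ j, Measurable (T j).symm
  commute : ∀ i j, Commute (T i) (T j)

/-- A freely generated totally ergodic system with generators `T₁, …, T_l`: commuting invertible
measure preserving transformations such that `T₁ ^ c₁ ⋯ T_l ^ c_l` is ergodic whenever
`(c₁, …, c_l) ≠ 0`. -/
structure IsFreelyGeneratedTotallyErgodic {X : Type*} [MeasurableSpace X] {l : ℕ} (μ : Measure X)
    (T : Fin l → Equiv.Perm X) : Prop extends IsSystem μ T where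
  ergodic : ∀ c : Fin l → ℤ, c ≠ 0 → Ergodic (monomialMap T c) μ

/-! ### Polynomials `ℤ^d → ℤ`, ED-sets, Følner sequences -/

/-- `p : ℤ^d → ℤ` is a polynomial: it is given by a polynomial in `d` variables. The coefficients
are rational, so that all integer valued polynomials, such as `u (u - 1) / 2`, are included. -/
def IsIntPolynomial {d : ℕ} (p : (Fin d → ℤ) → ℤ) : Prop :=
  ∃ q : MvPolynomial (Fin d) ℚ, ∀ u : Fin d → ℤ, (p u : ℚ) = MvPolynomial.eval (fun a => (u a : ℚ)) q

/-- The family `p i j`, `1 ≤ i ≤ r`, `1 ≤ j ≤ l`, of polynomials `ℤ^d → ℤ` is an ED-set. -/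
structure IsEDSet {d r l : ℕ} (p : Fin r → Fin l → (Fin d → ℤ) → ℤ) : Prop where
  isIntPolynomial : ∀ i j, IsIntPolynomial (p i j)
  /-- No polynomial of the family is a nonzero constant. -/
  ne_const : ∀ i j, ∀ c : ℤ, (∀ u, p i j u = c) → c = 0
  /-- No two polynomials of the family differ by a nonzero constant. -/
  sub_ne_const : ∀ i₁ j₁ i₂ j₂, ∀ c : ℤ, (∀ u, p i₁ j₁ u - p i₂ j₂ u = c) → c = 0
  /-- There is no row of zeros. -/
  row_ne_zero : ∀ i, ∃ j, p i j ≠ 0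
  /-- There are no two identical rows. -/
  rows_ne : ∀ i₁ i₂, i₁ ≠ i₂ → ∃ j, p i₁ j ≠ p i₂ j

/-- A Følner sequence of (nonempty) finite subsets of `ℤ^d`. -/
structure IsFolner {d : ℕ} (Φ : ℕ → Finset (Fin d → ℤ)) : Prop where
  nonempty : ∀ N, (Φ N).Nonempty
  tendsto : ∀ g : Fin d → ℤ,
    Tendsto (fun N => ((symmDiff ((Φ N).image fun u => g + u) (Φ N)).card : ℝ) / ((Φ N).card : ℝ))
      atTop (𝓝 0)

/-- The average `|Φ|⁻¹ ∑_{u ∈ Φ} ∏_i f_i (T₁ ^ p_{i1}(u) ⋯ T_l ^ p_{il}(u) x)`. -/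
def polyAverage {X : Type*} {d r l : ℕ} (T : Fin l → Equiv.Perm X)
    (p : Fin r → Fin l → (Fin d → ℤ) → ℤ) (f : Fin r → X → ℝ) (Φ : Finset (Fin d → ℤ)) (x : X) :
    ℝ :=
  (Φ.card : ℝ)⁻¹ * ∑ u ∈ Φ, ∏ i, f i (monomialMap T (fun j => p i j u) x)

/-! ### Host–Kra measures, seminorms and factors -/

/-- The cube `X^[k] = X ^ (2 ^ k)`, as `X^[0] = X` and `X^[k+1] = X^[k] × X^[k]`. -/
def Cube (X : Type*) : ℕ → Type _
  | 0 => X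
  | k + 1 => Cube X k × Cube X k

/-- The product σ-algebra on the cube. -/
instance Cube.instMeasurableSpace {X : Type*} [mX : MeasurableSpace X] :
    ∀ k : ℕ, MeasurableSpace (Cube X k)
  | 0 => mX
  | k + 1 => @Prod.instMeasurableSpace (Cube X k) (Cube X k)
      (Cube.instMeasurableSpace k) (Cube.instMeasurableSpace k)

/-- The diagonal map `T^[k] = T × ⋯ × T` on the cube. -/
def cubeMap {X : Type*} (T : X → X) : ∀ k : ℕ, Cube X k → Cube X k
  | 0 => T
  | k + 1 => Prod.map (cubeMap T k) (cubeMap T k)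

/-- The function `x ↦ ∏_j f (x_j)` on the cube. -/
def cubeProd {X : Type*} (f : X → ℝ) : ∀ k : ℕ, Cube X k → ℝ
  | 0 => f
  | k + 1 => fun x => cubeProd f k x.1 * cubeProd f k x.2

/-- `ν` is the relatively independent square `m ×_I m` of `m` over the σ-algebra `I`:
`∫ F(x') G(x'') dν = ∫ E(F | I) E(G | I) dm` for all `F, G ∈ L^∞(m)`. -/
def IsRelIndepSquare {Y : Type*} (I : MeasurableSpace Y) {mY : MeasurableSpace Y} (m : Measure Y)
    (ν : Measure (Y × Y)) : Prop :=
  ∀ F G : Y → ℝ, MemLp F ∞ m → MemLp G ∞ m →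
    ∫ z, F z.1 * G z.2 ∂ν = ∫ y, (m[F|I]) y * (m[G|I]) y ∂m

/-- `ν` is the Host–Kra measure `μ_T^[k]`: `μ_T^[0] = μ`, and `μ_T^[k+1]` is the relatively
independent square of `μ_T^[k]` over the σ-algebra of `T^[k]`-invariant sets. There is at most one
such measure, and there is one if `X` is standard Borel: see `IsHostKraMeasure.unique` and
`exists_isHostKraMeasure`. -/
def IsHostKraMeasure {X : Type*} {mX : MeasurableSpace X} (μ : Measure X) (T : X → X) :
    ∀ k : ℕ, Measure (Cube X k) → Prop
  | 0, ν => ν = μ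
  | k + 1, ν => ∃ m : Measure (Cube X k), IsHostKraMeasure μ T k m ∧
      IsRelIndepSquare (MeasurableSpace.invariants (cubeMap T k)) m ν

/-- `s` is the value of the Host–Kra seminorm `|||f|||_{k,T}`, that is, the `s ≥ 0` with
`s ^ (2 ^ k) = ∫ ∏_j f (x_j) dμ_T^[k]`. -/
def IsHostKraSeminorm {X : Type*} {mX : MeasurableSpace X} (μ : Measure X) (T : X → X) (k : ℕ)
    (f : X → ℝ) (s : ℝ) : Prop :=
  0 ≤ s ∧ ∃ ν : Measure (Cube X k), IsHostKraMeasure μ T k ν ∧ s ^ (2 ^ k) = ∫ x, cubeProd f k x ∂ν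

/-- The σ-algebra `𝒵` is invariant under the bijection `S`, up to null sets: `S⁻¹ 𝒵 = 𝒵`. -/
def IsInvariantSigmaAlgebra {X : Type*} {mX : MeasurableSpace X} (μ : Measure X)
    (S : Equiv.Perm X) (𝒵 : MeasurableSpace X) : Prop :=
  ∀ A, MeasurableSet[𝒵] A →
    (∃ B, MeasurableSet[𝒵] B ∧ S ⁻¹' A =ᵐ[μ] B) ∧ (∃ B, MeasurableSet[𝒵] B ∧ S.symm ⁻¹' A =ᵐ[μ] B)

/-- `𝒵` is the σ-algebra `𝒵_k(X, T)` of the Host–Kra factor `Z_k(X, T)` (unique up to null sets):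
the `T`-invariant sub-σ-algebra such that, for all `f ∈ L^∞(μ)`, `E(f | 𝒵) = 0` if and only if
`|||f|||_{k+1,T} = 0`. -/
structure IsHostKraFactor {X : Type*} {mX : MeasurableSpace X} (μ : Measure X) (T : Equiv.Perm X)
    (k : ℕ) (𝒵 : MeasurableSpace X) : Prop where
  le : 𝒵 ≤ mX
  invariant : IsInvariantSigmaAlgebra μ T 𝒵
  condExp_eq_zero_iff : ∀ f : X → ℝ, MemLp f ∞ μ →
    (μ[f|𝒵] =ᵐ[μ] 0 ↔ IsHostKraSeminorm μ T (k + 1) f 0)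

/-- `𝒵` is a characteristic factor for `L²(μ)`-convergence of the averages along the polynomials
`p i j`. -/
structure IsCharacteristicFactor {X : Type*} {mX : MeasurableSpace X} {d r l : ℕ} (μ : Measure X)
    (T : Fin l → Equiv.Perm X) (p : Fin r → Fin l → (Fin d → ℤ) → ℤ) (𝒵 : MeasurableSpace X) :
    Prop where
  le : 𝒵 ≤ mX
  invariant : ∀ j, IsInvariantSigmaAlgebra μ (T j) 𝒵
  tendsto : ∀ f : Fin r → X → ℝ, (∀ i, MemLp (f i) ∞ μ) → (∃ i, μ[f i|𝒵] =ᵐ[μ] 0) →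
    ∀ Φ : ℕ → Finset (Fin d → ℤ), IsFolner Φ →
      Tendsto (fun N => eLpNorm (polyAverage T p f (Φ N)) 2 μ) atTop (𝓝 0)

/-! ### The Host–Kra measures are well defined -/

lemma IsRelIndepSquare.isProbabilityMeasure {Y : Type*} {I : MeasurableSpace Y} [mY : MeasurableSpace Y]
    {m : Measure Y} [IsProbabilityMeasure m] (hI : I ≤ mY)
    {ν : Measure (Y × Y)} (h : IsRelIndepSquare I m ν) : IsProbabilityMeasure ν := by
  have h1 := h (fun _ => 1) (fun _ => 1) (memLp_const 1) (memLp_const 1)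
  rw [condExp_const hI] at h1
  simp only [mul_one, integral_const, smul_eq_mul, probReal_univ] at h1
  refine ⟨?_⟩
  rw [Measure.real, ENNReal.toReal_eq_one_iff] at h1
  exact h1

lemma IsRelIndepSquare.unique {Y : Type*} {I : MeasurableSpace Y} [mY : MeasurableSpace Y]
    {m : Measure Y} [IsProbabilityMeasure m] (hI : I ≤ mY)
    {ν ν' : Measure (Y × Y)} (h : IsRelIndepSquare I m ν) (h' : IsRelIndepSquare I m ν') :
    ν = ν' := by
  have := h.isProbabilityMeasure hI
  have := h'.isProbabilityMeasure hI
  refine Measure.ext_prod fun {s t} hs ht => ?_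
  have key : ∀ ρ : Measure (Y × Y), ρ.real (s ×ˢ t) =
      ∫ z, s.indicator (fun _ => (1 : ℝ)) z.1 * t.indicator (fun _ => (1 : ℝ)) z.2 ∂ρ := by
    intro ρ
    rw [← integral_indicator_one (hs.prod ht)]
    congr 1
    ext z
    by_cases h1 : z.1 ∈ s <;> by_cases h2 : z.2 ∈ t <;> simp [Set.indicator, h1, h2]
  have e := (h _ _ (memLp_indicator_const ∞ hs 1 (by simp)) (memLp_indicator_const ∞ ht 1
    (by simp))).trans (h' _ _ (memLp_indicator_const ∞ hs 1 (by simp))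
      (memLp_indicator_const ∞ ht 1 (by simp))).symm
  rw [← key, ← key] at e
  exact (measureReal_eq_measureReal_iff).1 e

lemma IsHostKraMeasure.isProbabilityMeasure {X : Type*} [MeasurableSpace X] {μ : Measure X}
    [IsProbabilityMeasure μ] {T : X → X} :
    ∀ {k : ℕ} {ν : Measure (Cube X k)}, IsHostKraMeasure μ T k ν → IsProbabilityMeasure ν
  | 0, _, h => by
    obtain rfl : _ = μ := h
    assumption
  | k + 1, _, ⟨_, h, h'⟩ => by
    have := h.isProbabilityMeasure
    exact h'.isProbabilityMeasure (MeasurableSpace.invariants_le _)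

lemma IsHostKraMeasure.unique {X : Type*} [MeasurableSpace X] {μ : Measure X}
    [IsProbabilityMeasure μ] {T : X → X} :
    ∀ {k : ℕ} {ν ν' : Measure (Cube X k)}, IsHostKraMeasure μ T k ν → IsHostKraMeasure μ T k ν' →
      ν = ν'
  | 0, _, _, h, h' => h.trans h'.symm
  | k + 1, _, _, ⟨m, h, hν⟩, ⟨m', h', hν'⟩ => by
    obtain rfl := h.unique h'
    have := h.isProbabilityMeasure
    exact hν.unique (MeasurableSpace.invariants_le _) hν'

instance Cube.instStandardBorelSpace {X : Type*} [MeasurableSpace X] [h : StandardBorelSpace X] :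
    ∀ k : ℕ, StandardBorelSpace (Cube X k)
  | 0 => h
  | k + 1 =>
    have := Cube.instStandardBorelSpace (X := X) k
    inferInstanceAs (StandardBorelSpace (Cube X k × Cube X k))

lemma exists_isRelIndepSquare {Y : Type*} {I : MeasurableSpace Y} [mY : MeasurableSpace Y]
    [StandardBorelSpace Y] (m : Measure Y) [IsProbabilityMeasure m] (hI : I ≤ mY) :
    ∃ ν, IsRelIndepSquare I m ν := by
  let κ : Kernel Y Y := Kernel.comap (condExpKernel m I) id (measurable_id'' hI)
  have hκ : ∀ y, κ y = condExpKernel m I y := fun y => rfl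
  refine ⟨((κ ×ₖ κ) ∘ₖ Kernel.const Unit m) (), fun F G hF hG => ?_⟩
  have hbind : ∀ s, MeasurableSet s → ∫⁻ y, κ y s ∂m = m s := by
    intro s hs
    have h := congrArg (fun ρ : Measure Y => ρ s) (condExpKernel_comp_trim (μ := m) hI)
    rw [Measure.bind_apply hs (Kernel.aemeasurable _),
      lintegral_trim hI (Kernel.measurable_coe (condExpKernel m I) hs)] at h
    exact h
  have hfst : ((((κ ×ₖ κ) ∘ₖ Kernel.const Unit m) ()).map Prod.fst) = m := by
    ext s hs
    rw [Measure.map_apply measurable_fst hs, Kernel.comp_apply' _ _ _ (measurable_fst hs),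
      Kernel.const_apply, ← hbind s hs]
    refine lintegral_congr fun y => ?_
    rw [Kernel.prod_apply, ← Set.prod_univ, Measure.prod_prod, measure_univ, mul_one]
  have hsnd : ((((κ ×ₖ κ) ∘ₖ Kernel.const Unit m) ()).map Prod.snd) = m := by
    ext s hs
    rw [Measure.map_apply measurable_snd hs, Kernel.comp_apply' _ _ _ (measurable_snd hs),
      Kernel.const_apply, ← hbind s hs]
    refine lintegral_congr fun y => ?_
    rw [Kernel.prod_apply, ← Set.univ_prod, Measure.prod_prod, measure_univ, one_mul]
  set ν := ((κ ×ₖ κ) ∘ₖ Kernel.const Unit m) () with hν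
  have hF' : MemLp (fun z : Y × Y => F z.1) ∞ ν :=
    MemLp.comp_of_map (by rwa [hfst]) measurable_fst.aemeasurable
  have hG' : MemLp (fun z : Y × Y => G z.2) ∞ ν :=
    MemLp.comp_of_map (by rwa [hsnd]) measurable_snd.aemeasurable
  have hint : Integrable (fun z : Y × Y => F z.1 * G z.2) ν :=
    (hG'.mul hF' (r := ∞)).integrable le_top
  rw [Kernel.integral_comp hint]
  have e1 := condExp_ae_eq_integral_condExpKernel hI (hF.integrable le_top)
  have e2 := condExp_ae_eq_integral_condExpKernel hI (hG.integrable le_top)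
  simp only [Kernel.const_apply]
  refine integral_congr_ae ?_
  filter_upwards [e1, e2] with y h1 h2
  rw [h1, h2, Kernel.prod_apply, integral_prod_mul, hκ]

lemma exists_isHostKraMeasure {X : Type*} [MeasurableSpace X] [StandardBorelSpace X]
    (μ : Measure X) [IsProbabilityMeasure μ] (T : X → X) :
    ∀ k : ℕ, ∃ ν : Measure (Cube X k), IsHostKraMeasure μ T k ν
  | 0 => ⟨μ, rfl⟩
  | k + 1 => by
    obtain ⟨m, hm⟩ := exists_isHostKraMeasure μ T k
    have := hm.isProbabilityMeasure
    obtain ⟨ν, hν⟩ := exists_isRelIndepSquare m (MeasurableSpace.invariants_le (cubeMap T k))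
    exact ⟨ν, m, hm, hν⟩

end PolyErgodic

end

open PolyErgodic

/-! Expanding the square of the L² norm turns the problem into one about averages over `Φ N ×ˢ Φ N`
of correlations of the `2r` maps `p_i(u)`, `p_i(u')` (`integral_sq_polyAverage`). Each limit of such
averages along an ultrafilter is the value of an invariant mean on `ℤ^d × ℤ^d`, so it suffices that
every invariant mean of the correlation vanishes. What remains of the ED conditions is that `p_m(u)`
differs by a nonconstant map from each other member of the doubled family
(`IsEDSet.doubledFamily_sub_notMem`).

For families with this property, `exists_controlled` bounds the order of the seminorm needed, by PET
induction. The van der Corput inequality (`sq_mean_integral_le`) replaces a family by shifted copies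
of its differences with a base. If the new base is chosen of least degree, the numbers of leading
classes, listed from the top degree down, decrease lexicographically, while one copy of `p_m` stays
at nonconstant distance from the rest. The induction ends with families of degree one, where
`mean_correlation_pow_le` removes one function at a time, each removal raising the order of the
seminorm by one. The shifts are arbitrary, but the new families have bounded size, so only finitely
many weights occur and one order serves them all, independently of the system.

The linear case uses the recursion formula of the seminorms along an arbitrary nonzero `w ∈ ℤ^l`,
whereas the seminorms are built from a single `T_j`. By `differenceAverage_tendsto_and_le` the
formula holds along every ergodic transformation commuting with `T_j`: the `T_j`-averages and the
`S`-averages are both bounded below by their limits, so the two iterated limits agree. Total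
ergodicity makes every nonzero `w` act ergodically.

For the factors, a map commuting with `T_j` preserves the seminorms, hence the kernel of the
conditional expectation on `𝒵`, hence `𝒵` itself up to null sets; convergence is then a restatement
in terms of conditional expectations. -/

namespace PolyErgodic

/-! ### Polynomial maps between abelian groups -/

section PolynomialMaps

variable {A B : Type*} [AddCommGroup A] [AddCommGroup B]

/-- The difference operator `p ↦ (u ↦ p (u + h) - p u)`. -/
def diffHom (h : A) : (A → B) →+ (A → B) where
  toFun p u := p (u + h) - p u
  map_zero' := by ext; simp
  map_add' p q := by ext; simp only [Pi.add_apply]; abel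

/-- The polynomial maps `A → B` of degree less than `n`: those that are annihilated by any `n`
difference operators. -/
def polyLT (A B : Type*) [AddCommGroup A] [AddCommGroup B] : ℕ → AddSubgroup (A → B)
  | 0 => ⊥
  | n + 1 => ⨅ h : A, (polyLT A B n).comap (diffHom h)

lemma mem_polyLT_zero {p : A → B} : p ∈ polyLT A B 0 ↔ p = 0 := by
  simp [polyLT]

lemma mem_polyLT_succ {n : ℕ} {p : A → B} :
    p ∈ polyLT A B (n + 1) ↔ ∀ h, (fun u => p (u + h) - p u) ∈ polyLT A B n := by
  simp only [polyLT, AddSubgroup.mem_iInf, AddSubgroup.mem_comap]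
  rfl

lemma polyLT_le_succ (n : ℕ) : polyLT A B n ≤ polyLT A B (n + 1) := by
  induction n with
  | zero =>
    intro p hp
    rw [mem_polyLT_zero] at hp
    rw [mem_polyLT_succ]
    intro h
    rw [mem_polyLT_zero, hp]
    ext
    simp
  | succ n ih =>
    intro p hp
    rw [mem_polyLT_succ] at hp ⊢
    exact fun h => ih (hp h)

lemma polyLT_mono : Monotone (polyLT A B) := monotone_nat_of_le_succ polyLT_le_succ

lemma mem_polyLT_one {p : A → B} : p ∈ polyLT A B 1 ↔ ∀ u, p u = p 0 := by
  rw [mem_polyLT_succ]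
  simp only [mem_polyLT_zero]
  constructor
  · intro h u
    have := congrFun (h u) 0
    simpa [sub_eq_zero] using this
  · intro h v
    ext u
    simp [h (u + v), h u]

lemma translate_mem_polyLT {n : ℕ} {p : A → B} (hp : p ∈ polyLT A B n) (h : A) :
    (fun u => p (u + h)) ∈ polyLT A B n := by
  have h1 := (mem_polyLT_succ.1 (polyLT_le_succ n hp)) h
  convert add_mem h1 hp using 1
  ext u
  simp

lemma translate_mem_polyLT_iff {n : ℕ} {p : A → B} (h : A) :
    (fun u => p (u + h)) ∈ polyLT A B n ↔ p ∈ polyLT A B n := by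
  refine ⟨fun hp => ?_, fun hp => translate_mem_polyLT hp h⟩
  convert translate_mem_polyLT hp (-h) using 1
  ext u
  simp

/-- The induction reduces to degree zero, where `k • p = 0` forces `p = 0`. This is the one place
where torsion-freeness of the target enters. -/
lemma zsmul_mem_polyLT_iff [IsAddTorsionFree B] {n : ℕ} {p : A → B} {k : ℤ} (hk : k ≠ 0) :
    k • p ∈ polyLT A B n ↔ p ∈ polyLT A B n := by
  refine ⟨?_, fun hp => zsmul_mem hp k⟩
  induction n generalizing p with
  | zero =>
    rw [mem_polyLT_zero, mem_polyLT_zero]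
    exact fun h => zsmul_right_injective hk (h.trans (smul_zero k).symm)
  | succ n ih =>
    rw [mem_polyLT_succ, mem_polyLT_succ]
    intro hp h
    refine ih ?_
    convert hp h using 1
    ext u
    simp [zsmul_sub]

/-- The expression is the second difference in the steps `h` and `k`, which lowers the degree by
two. Thus differences are additive in the step up to terms two degrees below the original map. -/
lemma diff_add_mem_polyLT {n : ℕ} {p : A → B} (hp : p ∈ polyLT A B (n + 2)) (h k : A) :
    (fun u => p (u + (h + k)) - p u - (p (u + h) - p u) - (p (u + k) - p u)) ∈ polyLT A B n := by
  have := (mem_polyLT_succ.1 ((mem_polyLT_succ.1 hp) h)) k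
  convert this using 1
  ext u
  rw [show u + (h + k) = u + k + h by abel]
  abel

lemma diff_zsmul_mem_polyLT {n : ℕ} {p : A → B} (hp : p ∈ polyLT A B (n + 2)) (v : A) (c : ℤ) :
    (fun u => p (u + c • v) - p u - c • (p (u + v) - p u)) ∈ polyLT A B n := by
  induction c with
  | zero =>
    convert zero_mem (polyLT A B n) using 1
    ext u
    simp
  | succ i ih =>
    convert add_mem ih (diff_add_mem_polyLT hp ((i : ℤ) • v) v) using 1
    ext u
    simp only [Pi.add_apply, add_smul, one_smul]
    abel
  | pred i ih =>
    convert sub_mem ih (diff_add_mem_polyLT hp ((-(i : ℤ) - 1) • v) v) using 1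
    ext u
    simp only [Pi.sub_apply, sub_smul, one_smul, sub_add_cancel]
    abel

/-- A polynomial map of degree at most one is additive up to a constant. -/
lemma apply_add_of_mem_polyLT_two {p : A → B} (hp : p ∈ polyLT A B 2) (u h : A) :
    p (u + h) = p u + p h - p 0 := by
  have := mem_polyLT_zero.1 (diff_add_mem_polyLT (n := 0) hp u h)
  have := congrFun this 0
  simp only [zero_add, Pi.zero_apply] at this
  rw [← sub_eq_zero, ← this]
  abel

lemma polyLT_sub_comm {n : ℕ} {p q : A → B} (h : p - q ∈ polyLT A B n) :
    q - p ∈ polyLT A B n := by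
  rw [← neg_sub]
  exact neg_mem h

end PolynomialMaps

/-! ### Invariant means -/

/-- An invariant mean on the bounded functions on the abelian group `A`. The values on unbounded
functions are irrelevant. -/
structure InvariantMean (A : Type*) [AddCommGroup A] where
  /-- the mean of a function -/
  mean : (A → ℝ) → ℝ
  mean_add : ∀ φ ψ : A → ℝ, (∃ C, ∀ a, |φ a| ≤ C) → (∃ C, ∀ a, |ψ a| ≤ C) →
    mean (fun a => φ a + ψ a) = mean φ + mean ψ
  mean_const_mul : ∀ (c : ℝ) (φ : A → ℝ), (∃ C, ∀ a, |φ a| ≤ C) →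
    mean (fun a => c * φ a) = c * mean φ
  mean_nonneg : ∀ φ : A → ℝ, (∃ C, ∀ a, |φ a| ≤ C) → (∀ a, 0 ≤ φ a) → 0 ≤ mean φ
  mean_one : mean (fun _ => 1) = 1
  mean_translate : ∀ (φ : A → ℝ) (h : A), (∃ C, ∀ a, |φ a| ≤ C) →
    mean (fun a => φ (a + h)) = mean φ

namespace InvariantMean

variable {A : Type*} [AddCommGroup A] (M : InvariantMean A)

lemma mean_const (c : ℝ) : M.mean (fun _ => c) = c := by
  have := M.mean_const_mul c (fun _ => 1) ⟨1, by simp⟩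
  simpa [M.mean_one] using this

lemma mean_mono {φ ψ : A → ℝ} (hφ : ∃ C, ∀ a, |φ a| ≤ C) (hψ : ∃ C, ∀ a, |ψ a| ≤ C)
    (h : ∀ a, φ a ≤ ψ a) : M.mean φ ≤ M.mean ψ := by
  obtain ⟨C, hC⟩ := hφ
  obtain ⟨D, hD⟩ := hψ
  have hneg : ∃ C, ∀ a, |(-1 : ℝ) * φ a| ≤ C := ⟨C, fun a => by simpa using hC a⟩
  have h1 := M.mean_nonneg (fun a => ψ a + (-1) * φ a)
    ⟨D + C, fun a => (abs_add_le _ _).trans (add_le_add (hD a) (by simpa using hC a))⟩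
    (fun a => by linarith [h a])
  rw [M.mean_add _ _ ⟨D, hD⟩ hneg, M.mean_const_mul _ _ ⟨C, hC⟩] at h1
  linarith

lemma mean_sum {ι : Type*} (s : Finset ι) (φ : ι → A → ℝ) (hφ : ∀ i, ∃ C, ∀ a, |φ i a| ≤ C) :
    M.mean (fun a => ∑ i ∈ s, φ i a) = ∑ i ∈ s, M.mean (φ i) := by
  classical
  choose C hC using hφ
  induction s using Finset.induction_on with
  | empty => simp [M.mean_const]
  | insert i s hi ih =>
    simp only [Finset.sum_insert hi]
    rw [M.mean_add _ _ ⟨C i, hC i⟩ ⟨∑ i ∈ s, C i, fun a => (Finset.abs_sum_le_sum_abs _ _).trans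
      (Finset.sum_le_sum fun i _ => hC i a)⟩, ih]

/-- This is positivity of the mean of `(φ - M.mean φ) ^ 2`. -/
lemma sq_mean_le {φ : A → ℝ} (hφ : ∃ C, ∀ a, |φ a| ≤ C) :
    M.mean φ ^ 2 ≤ M.mean (fun a => φ a ^ 2) := by
  obtain ⟨C, hC⟩ := hφ
  have hsq : ∃ D, ∀ a, |φ a ^ 2| ≤ D := ⟨C ^ 2, fun a => by
    rw [abs_pow]; exact pow_le_pow_left₀ (abs_nonneg _) (hC a) 2⟩
  have hlin : ∃ D, ∀ a, |2 * M.mean φ * φ a| ≤ D := ⟨|2 * M.mean φ| * C, fun a => by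
    rw [abs_mul]; exact mul_le_mul_of_nonneg_left (hC a) (abs_nonneg _)⟩
  obtain ⟨D, hD⟩ := hsq
  have h1 := M.mean_mono hlin
    (ψ := fun a => φ a ^ 2 + M.mean φ ^ 2) ⟨D + |M.mean φ ^ 2|, fun a =>
      (abs_add_le _ _).trans (add_le_add_left (hD a) _)⟩
    (fun a => by nlinarith [sq_nonneg (φ a - M.mean φ)])
  rw [M.mean_const_mul _ _ ⟨C, hC⟩, M.mean_add _ _ ⟨D, hD⟩ ⟨_, fun _ => le_rfl⟩,
    M.mean_const] at h1
  linarith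

end InvariantMean

/-! ### Functions bounded by one, actions -/

/-- `f` is measurable with values in `[-1, 1]`. -/
structure UnitBounded {X : Type*} [MeasurableSpace X] (f : X → ℝ) : Prop where
  measurable : Measurable f
  abs_le : ∀ x, |f x| ≤ 1

namespace UnitBounded

variable {X : Type*} [MeasurableSpace X] {f g : X → ℝ}

lemma mul (hf : UnitBounded f) (hg : UnitBounded g) : UnitBounded (fun x => f x * g x) :=
  ⟨hf.measurable.mul hg.measurable, fun x => by
    rw [abs_mul]; exact mul_le_one₀ (hf.abs_le x) (abs_nonneg _) (hg.abs_le x)⟩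

lemma comp {Y : Type*} [MeasurableSpace Y] (hf : UnitBounded f) {S : Y → X} (hS : Measurable S) :
    UnitBounded (fun x => f (S x)) :=
  ⟨hf.measurable.comp hS, fun _ => hf.abs_le _⟩

lemma prod {ι : Type*} {s : Finset ι} {f : ι → X → ℝ} (hf : ∀ i, UnitBounded (f i)) :
    UnitBounded (fun x => ∏ i ∈ s, f i x) :=
  ⟨Finset.measurable_prod _ fun i _ => (hf i).measurable, fun x => by
    rw [Finset.abs_prod]
    exact Finset.prod_le_one (fun i _ => abs_nonneg _) fun i _ => (hf i).abs_le x⟩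

lemma memLp (hf : UnitBounded f) (q : ℝ≥0∞) (μ : Measure X) [IsFiniteMeasure μ] : MemLp f q μ :=
  MemLp.of_bound hf.measurable.aestronglyMeasurable 1 (ae_of_all _ fun x => hf.abs_le x)

lemma integrable (hf : UnitBounded f) (μ : Measure X) [IsFiniteMeasure μ] : Integrable f μ :=
  (hf.memLp 1 μ).integrable le_rfl

lemma abs_integral_le (hf : UnitBounded f) (μ : Measure X) [IsProbabilityMeasure μ] :
    |∫ x, f x ∂μ| ≤ 1 := by
  have := norm_integral_le_of_norm_le_const (μ := μ) (f := f) (C := 1) (ae_of_all _ hf.abs_le)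
  simpa using this

end UnitBounded

/-- `τ` is a measure preserving action of the group `B`. -/
structure IsAction {B X : Type*} [AddCommGroup B] [MeasurableSpace X] (μ : Measure X)
    (τ : B → X → X) : Prop where
  zero : ∀ x, τ 0 x = x
  add : ∀ a b x, τ (a + b) x = τ a (τ b x)
  measurePreserving : ∀ a, MeasurePreserving (τ a) μ μ

lemma IsAction.integral_comp {B X : Type*} [AddCommGroup B] [MeasurableSpace X] {μ : Measure X}
    {τ : B → X → X} (h : IsAction μ τ) (a : B) {f : X → ℝ} (hf : Measurable f) :
    ∫ x, f (τ a x) ∂μ = ∫ x, f x ∂μ := by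
  rw [← integral_map (h.measurePreserving a).measurable.aemeasurable
    hf.aestronglyMeasurable, (h.measurePreserving a).map_eq]

/-- Functionals `Q n`, `n ≤ K`, which behave like the `2 ^ n`-th powers of the uniformity seminorms
of the action `τ`, with the recursion formula holding for each single nonzero element. -/
structure IsUniformity {B X : Type*} [AddCommGroup B] [MeasurableSpace X] (μ : Measure X)
    (τ : B → X → X) (K : ℕ) (Q : ℕ → (X → ℝ) → ℝ) : Prop where
  zero : ∀ f, UnitBounded f → Q 0 f = ∫ x, f x ∂μ
  comp : ∀ n ≤ K, ∀ f, UnitBounded f → ∀ c, Q n (fun x => f (τ c x)) = Q n f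
  sq_le : ∀ n < K, ∀ f, UnitBounded f → Q n f ^ 2 ≤ Q (n + 1) f
  tendsto : ∀ n < K, ∀ f, UnitBounded f → ∀ w : B, w ≠ 0 →
    Tendsto (fun J : ℕ => ((J : ℝ) ^ 2)⁻¹ * ∑ i ∈ Finset.range J, ∑ j ∈ Finset.range J,
      Q n (fun x => f (τ (i • w) x) * f (τ (j • w) x))) atTop (𝓝 (Q (n + 1) f))

/-- Vanishing descends one level at a time, since the square of each level is bounded by the next.
-/
lemma IsUniformity.eq_zero_of_le {B X : Type*} [AddCommGroup B] [MeasurableSpace X] {μ : Measure X}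
    {τ : B → X → X} {K : ℕ} {Q : ℕ → (X → ℝ) → ℝ} (hQ : IsUniformity μ τ K Q) {f : X → ℝ}
    (hf : UnitBounded f) (h : Q K f = 0) {n : ℕ} (hn : n ≤ K) : Q n f = 0 := by
  induction hn using Nat.decreasingInduction with
  | self => exact h
  | of_succ k hk ih =>
    have := hQ.sq_le k hk f hf
    rw [ih] at this
    exact pow_eq_zero_iff (two_ne_zero) |>.1 (le_antisymm this (sq_nonneg _))

/-- The correlation `∫ ∏ᵢ fᵢ (τ (pᵢ u) x) dμ`. -/
noncomputable def correlation {A B X ι : Type*} [MeasurableSpace X] [Fintype ι] (μ : Measure X) (τ : B → X → X)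
    (p : ι → A → B) (f : ι → X → ℝ) (u : A) : ℝ :=
  ∫ x, ∏ i, f i (τ (p i u) x) ∂μ

lemma unitBounded_prod_action {B X ι : Type*} [AddCommGroup B] [MeasurableSpace X]
    {μ : Measure X} {τ : B → X → X} (hτ : IsAction μ τ) {s : Finset ι} {f : ι → X → ℝ}
    (hf : ∀ i, UnitBounded (f i)) (c : ι → B) : UnitBounded (fun x => ∏ i ∈ s, f i (τ (c i) x)) :=
  UnitBounded.prod fun i => (hf i).comp (hτ.measurePreserving (c i)).measurable

section Correlation

variable {A B X ι : Type*} [AddCommGroup B] [MeasurableSpace X] [Fintype ι]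
  {μ : Measure X} {τ : B → X → X}

lemma abs_correlation_le [IsProbabilityMeasure μ] (hτ : IsAction μ τ) (p : ι → A → B) {f : ι → X → ℝ}
    (hf : ∀ i, UnitBounded (f i)) (u : A) : |correlation μ τ p f u| ≤ 1 :=
  (unitBounded_prod_action hτ hf _).abs_integral_le μ

/-- Move the point by `τ (q u)`, which preserves `μ`. With `q` a member of the family, its function
is freed of the dynamics. -/
lemma correlation_sub (hτ : IsAction μ τ) (p : ι → A → B) (q : A → B) {f : ι → X → ℝ}
    (hf : ∀ i, UnitBounded (f i)) (u : A) :
    correlation μ τ (fun i => p i - q) f u = correlation μ τ p f u := by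
  unfold correlation
  rw [← hτ.integral_comp (q u)
    (unitBounded_prod_action hτ hf (fun i => (p i - q) u)).measurable]
  refine integral_congr_ae (ae_of_all _ fun x => ?_)
  refine Finset.prod_congr rfl fun i _ => ?_
  rw [← hτ.add]
  simp

end Correlation

/-- The van der Corput inequality. -/
lemma sq_mean_integral_le {A X : Type*} [AddCommGroup A] [MeasurableSpace X] {μ : Measure X}
    [IsProbabilityMeasure μ] (M : InvariantMean A) {f₀ : X → ℝ} (h₀ : UnitBounded f₀)
    {g : A → X → ℝ} (hg : ∀ u, UnitBounded (g u)) (h : ℕ → A) {J : ℕ} (hJ : J ≠ 0) :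
    (M.mean fun u => ∫ x, f₀ x * g u x ∂μ) ^ 2 ≤
      ((J : ℝ) ^ 2)⁻¹ * ∑ i ∈ Finset.range J, ∑ j ∈ Finset.range J,
        M.mean fun u => ∫ x, g (u + h i) x * g (u + h j) x ∂μ := by
  have hJ' : (J : ℝ) ≠ 0 := Nat.cast_ne_zero.2 hJ
  have b1 : ∀ k, ∃ C, ∀ u, |∫ x, f₀ x * g (u + k) x ∂μ| ≤ C := fun k =>
    ⟨1, fun u => (h₀.mul (hg _)).abs_integral_le μ⟩
  have b2 : ∀ i j, ∃ C, ∀ u, |∫ x, g (u + i) x * g (u + j) x ∂μ| ≤ C := fun i j =>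
    ⟨1, fun u => ((hg _).mul (hg _)).abs_integral_le μ⟩
  have hbsum : ∀ (s : Finset ℕ) (φ : ℕ → A → ℝ), (∀ i, ∃ C, ∀ a, |φ i a| ≤ C) →
      ∃ C, ∀ a, |∑ i ∈ s, φ i a| ≤ C := by
    intro s φ hφ
    choose C hC using hφ
    exact ⟨∑ i ∈ s, C i, fun a => (Finset.abs_sum_le_sum_abs _ _).trans
      (Finset.sum_le_sum fun i _ => hC i a)⟩
  have hbmul : ∀ (c : ℝ) (φ : A → ℝ), (∃ C, ∀ a, |φ a| ≤ C) → ∃ C, ∀ a, |c * φ a| ≤ C := by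
    rintro c φ ⟨C, hC⟩
    exact ⟨|c| * C, fun a => by
      rw [abs_mul]; exact mul_le_mul_of_nonneg_left (hC a) (abs_nonneg _)⟩
  -- By translation invariance the mean is unchanged when `g u` is replaced by its average over the
  -- `J` shifts.
  have e1 : (M.mean fun u => ∫ x, f₀ x * g u x ∂μ) =
      M.mean fun u => (J : ℝ)⁻¹ * ∑ i ∈ Finset.range J, ∫ x, f₀ x * g (u + h i) x ∂μ := by
    rw [M.mean_const_mul _ _ (hbsum _ (fun i u => ∫ x, f₀ x * g (u + h i) x ∂μ) fun i => b1 _),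
      M.mean_sum _ (fun i u => ∫ x, f₀ x * g (u + h i) x ∂μ) fun i => b1 _]
    have : ∀ i, (M.mean fun u => ∫ x, f₀ x * g (u + h i) x ∂μ) =
        M.mean fun u => ∫ x, f₀ x * g u x ∂μ := fun i =>
      M.mean_translate (fun u => ∫ x, f₀ x * g u x ∂μ) (h i) (by simpa using b1 0)
    simp only [this, Finset.sum_const, Finset.card_range, nsmul_eq_mul]
    field_simp
  have e2 : (M.mean fun u => ((J : ℝ) ^ 2)⁻¹ * ∑ i ∈ Finset.range J, ∑ j ∈ Finset.range J,
      ∫ x, g (u + h i) x * g (u + h j) x ∂μ) = ((J : ℝ) ^ 2)⁻¹ * ∑ i ∈ Finset.range J,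
        ∑ j ∈ Finset.range J, M.mean fun u => ∫ x, g (u + h i) x * g (u + h j) x ∂μ := by
    rw [M.mean_const_mul _ _ (hbsum _ (fun i u => ∑ j ∈ Finset.range J,
      ∫ x, g (u + h i) x * g (u + h j) x ∂μ) fun i => hbsum _ _ fun j => b2 _ _),
      M.mean_sum _ (fun i u => ∑ j ∈ Finset.range J,
      ∫ x, g (u + h i) x * g (u + h j) x ∂μ) fun i => hbsum _ _ fun j => b2 _ _]
    congr 1
    refine Finset.sum_congr rfl fun i _ => ?_
    exact M.mean_sum _ (fun j u => ∫ x, g (u + h i) x * g (u + h j) x ∂μ) fun j => b2 _ _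
  rw [e1, ← e2]
  have b3 := hbmul (J : ℝ)⁻¹ _ (hbsum (Finset.range J)
    (fun i u => ∫ x, f₀ x * g (u + h i) x ∂μ) fun i => b1 _)
  refine (M.sq_mean_le b3).trans (M.mean_mono ?_ ?_ fun u => ?_)
  · obtain ⟨C, hC⟩ := b3
    exact ⟨C ^ 2, fun u => by
      rw [abs_pow]; exact pow_le_pow_left₀ (abs_nonneg _) (hC u) 2⟩
  · exact hbmul _ _ (hbsum _ _ fun i => hbsum _ _ fun j => b2 _ _)
  · set G : X → ℝ := fun x => (J : ℝ)⁻¹ * ∑ i ∈ Finset.range J, g (u + h i) x with hG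
    have hGm : Measurable G := (Finset.measurable_sum _ fun i _ => (hg _).measurable).const_mul _
    have hGb : ∀ x, |G x| ≤ 1 := by
      intro x
      rw [hG]
      simp only [abs_mul, abs_inv, Nat.abs_cast]
      rw [inv_mul_le_iff₀ (by positivity), mul_one]
      refine (Finset.abs_sum_le_sum_abs _ _).trans ?_
      refine (Finset.sum_le_sum fun i _ => (hg (u + h i)).abs_le x).trans (by simp)
    have hGU : UnitBounded G := ⟨hGm, hGb⟩
    have e3 : (J : ℝ)⁻¹ * ∑ i ∈ Finset.range J, ∫ x, f₀ x * g (u + h i) x ∂μ =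
        ∫ x, f₀ x * G x ∂μ := by
      rw [← integral_finsetSum _ fun i _ => (h₀.mul (hg _)).integrable μ, ← integral_const_mul]
      congr 1
      ext x
      simp only [hG, Finset.mul_sum]
      refine Finset.sum_congr rfl fun i _ => by ring
    have e4 : ((J : ℝ) ^ 2)⁻¹ * ∑ i ∈ Finset.range J, ∑ j ∈ Finset.range J,
        ∫ x, g (u + h i) x * g (u + h j) x ∂μ = ∫ x, G x ^ 2 ∂μ := by
      have : ∀ i, ∑ j ∈ Finset.range J, ∫ x, g (u + h i) x * g (u + h j) x ∂μ =
          ∫ x, ∑ j ∈ Finset.range J, g (u + h i) x * g (u + h j) x ∂μ := fun i =>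
        (integral_finsetSum _ fun j _ => ((hg _).mul (hg _)).integrable μ).symm
      simp only [this]
      rw [← integral_finsetSum _ fun i _ => integrable_finsetSum _ fun j _ =>
        ((hg _).mul (hg _)).integrable μ, ← integral_const_mul]
      congr 1
      ext x
      simp only [hG]
      rw [mul_pow, inv_pow, sq (∑ i ∈ Finset.range J, g (u + h i) x), Finset.sum_mul_sum]
    rw [e3, e4]
    -- Cauchy–Schwarz on a probability space, in the form that the variance of `f₀ * G` is
    -- nonnegative; afterwards `|f₀| ≤ 1` removes `f₀`.
    have hv := ProbabilityTheory.variance_nonneg (fun x => f₀ x * G x) μ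
    rw [ProbabilityTheory.variance_eq_sub ((h₀.mul hGU).memLp 2 μ)] at hv
    refine (sub_nonneg.1 hv).trans (integral_mono_of_nonneg (ae_of_all _ fun x => sq_nonneg _)
      ((hGU.mul hGU).integrable μ |>.congr (ae_of_all _ fun x => (sq _).symm))
      (ae_of_all _ fun x => ?_))
    simp only [Pi.pow_apply, mul_pow]
    refine mul_le_of_le_one_left (sq_nonneg _) ?_
    rw [← sq_abs]
    exact pow_le_one₀ (abs_nonneg _) (h₀.abs_le x)

/-! ### Polynomial families controlled by a uniformity seminorm -/

universe u

/-- In every system, the mean of the correlation along the family `p` vanishes if the `K`-th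
uniformity seminorm of the function with index `m` does. -/
def Controlled {A B ι : Type} [AddCommGroup A] [AddCommGroup B] [Fintype ι] (K : ℕ)
    (p : ι → A → B) (m : ι) : Prop :=
  ∀ (X : Type u) [MeasurableSpace X] (μ : Measure X) [IsProbabilityMeasure μ] (τ : B → X → X)
    (Q : ℕ → (X → ℝ) → ℝ), IsAction μ τ → IsUniformity μ τ K Q → ∀ (M : InvariantMean A)
    (f : ι → X → ℝ), (∀ i, UnitBounded (f i)) → Q K (f m) = 0 →
      M.mean (correlation μ τ p f) = 0

lemma IsUniformity.of_le {B X : Type*} [AddCommGroup B] [MeasurableSpace X] {μ : Measure X}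
    {τ : B → X → X} {K K' : ℕ} {Q : ℕ → (X → ℝ) → ℝ} (hQ : IsUniformity μ τ K' Q) (h : K ≤ K') :
    IsUniformity μ τ K Q where
  zero := hQ.zero
  comp n hn := hQ.comp n (hn.trans h)
  sq_le n hn := hQ.sq_le n (hn.trans_le h)
  tendsto n hn := hQ.tendsto n (hn.trans_le h)

lemma Controlled.mono {A B ι : Type} [AddCommGroup A] [AddCommGroup B] [Fintype ι] {K K' : ℕ}
    {p : ι → A → B} {m : ι} (h : Controlled.{u} K p m) (hK : K ≤ K') : Controlled.{u} K' p m :=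
  fun X _ μ _ τ Q hτ hQ M f hf h0 =>
    h X μ τ Q hτ (hQ.of_le hK) M f hf (hQ.eq_zero_of_le (hf m) h0 hK)

/-- Jensen's inequality for the power `2 ^ n`, by iterating Cauchy–Schwarz. -/
lemma mean_pow_two_pow_le {ι : Type*} (s : Finset ι) (x : ι → ℝ) (n : ℕ) :
    ((s.card : ℝ)⁻¹ * ∑ i ∈ s, x i) ^ 2 ^ n ≤ (s.card : ℝ)⁻¹ * ∑ i ∈ s, x i ^ 2 ^ n := by
  rcases s.eq_empty_or_nonempty with rfl | hs
  · simp
  have hc : (0 : ℝ) < s.card := by exact_mod_cast hs.card_pos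
  induction n generalizing x with
  | zero => simp
  | succ n ih =>
    simp only [pow_succ' 2 n, pow_mul]
    refine le_trans (pow_le_pow_left₀ (sq_nonneg _) ?_ _) (ih fun i => x i ^ 2)
    have := sq_sum_le_card_mul_sum_sq (s := s) (f := x)
    rw [mul_pow, inv_pow, inv_mul_le_iff₀ (by positivity)]
    calc _ ≤ _ := this
      _ = _ := by field_simp

/-- Correlations along families of polynomials of degree one are bounded by uniformity
seminorms. -/
lemma mean_correlation_pow_le {A B X : Type*} [AddCommGroup A] [AddCommGroup B]
    [MeasurableSpace X] {μ : Measure X} [IsProbabilityMeasure μ] {τ : B → X → X} {K : ℕ}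
    {Q : ℕ → (X → ℝ) → ℝ} (hτ : IsAction μ τ) (hQ : IsUniformity μ τ K Q) (M : InvariantMean A)
    {n : ℕ} (hn : n ≤ K) {ι : Type*} [Fintype ι] (hι : Fintype.card ι = n + 1)
    {p : ι → A → B} {m : ι} (hp : ∀ i j, p i - p j ∈ polyLT A B 2)
    (hm : ∀ i, i ≠ m → p m - p i ∉ polyLT A B 1) {f : ι → X → ℝ} (hf : ∀ i, UnitBounded (f i)) :
    M.mean (correlation μ τ p f) ^ 2 ^ n ≤ Q n (f m) := by
  classical
  induction n generalizing ι with
  | zero =>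
    have hu : ∀ i, i = m := fun i => (Fintype.card_le_one_iff.1 (by omega)) i m
    have : correlation μ τ p f = fun _ => Q 0 (f m) := by
      ext u
      rw [hQ.zero _ (hf m), ← hτ.integral_comp (p m u) (hf m).measurable]
      unfold correlation
      congr 1
      ext x
      rw [Fintype.prod_eq_single m fun i hi => absurd (hu i) hi]
    rw [this, M.mean_const]
    simp
  | succ n ih =>
    -- Any member other than `m` can be eliminated: after subtraction of `p b` its function no
    -- longer moves with `u` and becomes the weight `f₀` of the van der Corput inequality.
    obtain ⟨b, hb⟩ : ∃ b, b ≠ m := by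
      have : Nontrivial ι := Fintype.one_lt_card_iff_nontrivial.1 (by omega)
      exact exists_ne m
    set q : ι → A → B := fun i => p i - p b with hq
    have hq2 : ∀ i, q i ∈ polyLT A B 2 := fun i => hp i b
    have hqadd : ∀ i u h, q i (u + h) = q i u + (q i h - q i 0) := fun i u h => by
      rw [apply_add_of_mem_polyLT_two (hq2 i)]
      abel
    obtain ⟨v, hv⟩ : ∃ v, q m v ≠ q m 0 := by
      have := hm b hb
      rw [mem_polyLT_one] at this
      push Not at this
      exact this
    -- As `q m` is affine, the shift by `j • v` moves the function with index `m` by `j • w`. The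
    -- recursion formula will be applied along `w`.
    set w := q m v - q m 0 with hw
    have hw0 : w ≠ 0 := sub_ne_zero.2 hv
    have hmul : ∀ j : ℕ, q m (j • v) - q m 0 = j • w := by
      intro j
      induction j with
      | zero => simp
      | succ j ihj =>
        rw [succ_nsmul, hqadd, succ_nsmul, ← ihj, hw]
        abel
    let c : ℕ → ι → B := fun j k => q k (j • v) - q k 0
    let g : A → X → ℝ := fun u x => ∏ k : {k // k ≠ b}, f k (τ (q k u) x)
    have hg : ∀ u, UnitBounded (g u) := fun u =>
      unitBounded_prod_action hτ (f := fun k : {k // k ≠ b} => f k) (fun k => hf k) _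
    let F : ℕ → ℕ → {k // k ≠ b} → X → ℝ := fun i j k x => f k (τ (c i k) x) * f k (τ (c j k) x)
    have hF : ∀ i j k, UnitBounded (F i j k) := fun i j k =>
      ((hf k).comp (hτ.measurePreserving _).measurable).mul
        ((hf k).comp (hτ.measurePreserving _).measurable)
    have e1 : correlation μ τ p f = fun u => ∫ x, f b x * g u x ∂μ := by
      ext u
      rw [← correlation_sub hτ p (p b) hf]
      unfold correlation
      congr 1
      ext x
      rw [Fintype.prod_eq_mul_prod_subtype_ne _ b]
      simp only [sub_self, Pi.zero_apply, hτ.zero]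
      rfl
    -- For affine maps the shifts are absorbed into the functions, so the polynomials stay the same
    -- and only `b` is lost.
    have e2 : ∀ i j : ℕ, (fun u => ∫ x, g (u + i • v) x * g (u + j • v) x ∂μ) =
        correlation μ τ (fun k : {k // k ≠ b} => q k) (F i j) := by
      intro i j
      ext u
      unfold correlation
      congr 1
      ext x
      simp only [g, F, c, ← Finset.prod_mul_distrib]
      refine Finset.prod_congr rfl fun k _ => ?_
      rw [hqadd, hqadd, add_comm (q k u), hτ.add, add_comm (q k u), hτ.add]
    have key : ∀ J : ℕ, J ≠ 0 → M.mean (correlation μ τ p f) ^ 2 ^ (n + 1) ≤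
        ((J : ℝ) ^ 2)⁻¹ * ∑ i ∈ Finset.range J, ∑ j ∈ Finset.range J,
          Q n (fun x => f m (τ (i • w) x) * f m (τ (j • w) x)) := by
      intro J hJ
      have h1 := sq_mean_integral_le M (hf b) hg (fun j => j • v) hJ (μ := μ)
      simp only [e2] at h1
      rw [← e1] at h1
      rw [pow_succ', pow_mul]
      refine (pow_le_pow_left₀ (sq_nonneg _) h1 _).trans ?_
      rw [← Finset.sum_product', ← Finset.sum_product']
      have h2 := mean_pow_two_pow_le (Finset.range J ×ˢ Finset.range J) (fun x : ℕ × ℕ =>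
        M.mean (correlation μ τ (fun k : {k // k ≠ b} => q k) (F x.1 x.2))) n
      have h3 : (((Finset.range J ×ˢ Finset.range J).card : ℕ) : ℝ) = (J : ℝ) ^ 2 := by
        simp [sq]
      rw [h3] at h2
      refine h2.trans (mul_le_mul_of_nonneg_left (Finset.sum_le_sum fun x _ => ?_) (by positivity))
      have h4 := ih (by omega) (ι := {k // k ≠ b}) (by
          rw [Fintype.card_subtype_compl, Fintype.card_subtype_eq, hι]; rfl)
        (p := fun k => q k) (m := ⟨m, hb.symm⟩)
        (fun i j => by simpa [hq] using hp i j)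
        (fun i hi => by
          have := hm i (fun h => hi (Subtype.ext h))
          simpa [hq] using this) (hF x.1 x.2)
      simpa only [F, c, hmul] using h4
    -- The bound holds for every nonzero `J`, and its right side converges to the functional of the
    -- next level.
    refine ge_of_tendsto (hQ.tendsto n (by omega) (f m) (hf m) w hw0) ?_
    filter_upwards [eventually_ne_atTop 0] with J hJ using key J hJ

/-- With at least two members the exponent in `mean_correlation_pow_le` is even, so the upper bound
zero forces the mean to vanish. -/
lemma Controlled.of_linear {A B ι : Type} [AddCommGroup A] [AddCommGroup B] [Fintype ι]
    {p : ι → A → B} {m b : ι} (hb : b ≠ m) (hp : ∀ i j, p i - p j ∈ polyLT A B 2)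
    (hm : ∀ i, i ≠ m → p m - p i ∉ polyLT A B 1) : Controlled.{u} (Fintype.card ι) p m := by
  intro X _ μ _ τ Q hτ hQ M f hf h0
  have : Nontrivial ι := ⟨b, m, hb⟩
  obtain ⟨n, hn⟩ : ∃ n, Fintype.card ι = n + 2 :=
    ⟨Fintype.card ι - 2, by have := Fintype.one_lt_card (α := ι); omega⟩
  have h1 := mean_correlation_pow_le hτ hQ M (n := n + 1) (by omega) hn hp hm hf
  rw [hQ.eq_zero_of_le (hf m) h0 (by omega)] at h1
  have h2 : Even (2 ^ (n + 1)) := by simp [Nat.even_pow]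
  exact (pow_eq_zero_iff (by positivity)).1 (le_antisymm h1 (h2.pow_nonneg _))

section VanDerCorput

variable {A B ι : Type} [AddCommGroup A] [AddCommGroup B]

/-- The members of the family `p` whose difference from `p b` is not constant. -/
abbrev Nonconst (p : ι → A → B) (b : ι) : Type := {i // p i - p b ∉ polyLT A B 1}

/-- The family obtained from `p` by the van der Corput operation with base `b` and shifts
`h`, `h'`. -/
def vdcFamily (p : ι → A → B) (b : ι) (h h' : A) (x : Nonconst p b × Bool) (u : A) : B :=
  (p x.1 - p b) (u + if x.2 then h else h')

-- Members at constant distance from `p b` do not move after subtraction of `p b` and are collected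
-- in the weight `f₀`. The other members appear twice, once for each shift. It is enough to control
-- pairs of distinct shifts, since the `J` diagonal pairs contribute at most `1 / J` to the average
-- over all `J ^ 2` pairs.
open Classical in
lemma Controlled.of_vdcFamily [Fintype ι] {K : ℕ} {p : ι → A → B} {b m : ι}
    (hm : p m - p b ∉ polyLT A B 1) (h : ℕ → A)
    (H : ∀ i j, i ≠ j → Controlled.{u} K (vdcFamily p b (h i) (h j)) (⟨m, hm⟩, false)) :
    Controlled.{u} K p m := by
  intro X _ μ _ τ Q hτ hQ M f hf h0
  let q : ι → A → B := fun i => p i - p b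
  let g : A → X → ℝ := fun u x => ∏ k : Nonconst p b, f k (τ (q k u) x)
  let f₀ : X → ℝ := fun x => ∏ k : {k // ¬ q k ∉ polyLT A B 1}, f k (τ (q k 0) x)
  have hg : ∀ u, UnitBounded (g u) := fun u =>
    unitBounded_prod_action hτ (f := fun k : Nonconst p b => f k) (fun k => hf k) _
  have hf₀ : UnitBounded f₀ :=
    unitBounded_prod_action hτ (f := fun k : {k // ¬ q k ∉ polyLT A B 1} => f k) (fun k => hf k) _
  have e1 : correlation μ τ p f = fun u => ∫ x, f₀ x * g u x ∂μ := by
    ext u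
    rw [← correlation_sub hτ p (p b) hf]
    unfold correlation
    congr 1
    ext x
    rw [← Fintype.prod_subtype_mul_prod_subtype (fun i => q i ∉ polyLT A B 1), mul_comm]
    congr 1
    refine Finset.prod_congr rfl fun k _ => ?_
    have := mem_polyLT_one.1 (not_not.1 k.2) u
    rw [← this]
  have e2 : ∀ i j : ℕ, (fun u => ∫ x, g (u + h i) x * g (u + h j) x ∂μ) =
      correlation μ τ (vdcFamily p b (h i) (h j)) (fun x => f x.1) := by
    intro i j
    ext u
    unfold correlation
    congr 1
    ext x
    simp only [g, ← Finset.prod_mul_distrib, Fintype.prod_prod_type, Fintype.prod_bool, vdcFamily]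
    simp [q]
  have key : ∀ J : ℕ, J ≠ 0 → M.mean (correlation μ τ p f) ^ 2 ≤ (J : ℝ)⁻¹ := by
    intro J hJ
    have h1 := sq_mean_integral_le M hf₀ hg h hJ (μ := μ)
    simp only [e2] at h1
    rw [← e1] at h1
    refine h1.trans ?_
    have hJ' : (J : ℝ) ≠ 0 := Nat.cast_ne_zero.2 hJ
    have h2 : ∀ i ∈ Finset.range J, ∑ j ∈ Finset.range J,
        M.mean (correlation μ τ (vdcFamily p b (h i) (h j)) (fun x => f x.1)) ≤ 1 := by
      intro i hi
      rw [Finset.sum_eq_single i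
        (fun j _ hij => H i j hij.symm X μ τ Q hτ hQ M _ (fun x => hf x.1) h0)
        (fun h => absurd hi h)]
      have hb := abs_correlation_le hτ (vdcFamily p b (h i) (h i)) (f := fun x => f x.1)
        (fun x => hf x.1) (μ := μ)
      refine (M.mean_mono ⟨1, hb⟩ ⟨1, fun _ => by simp⟩
        (fun u => (le_abs_self _).trans (hb u))).trans_eq M.mean_one
    calc _ ≤ ((J : ℝ) ^ 2)⁻¹ * ∑ i ∈ Finset.range J, (1 : ℝ) :=
          mul_le_mul_of_nonneg_left (Finset.sum_le_sum h2) (by positivity)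
      _ = _ := by simp; field_simp
  have hlim : M.mean (correlation μ τ p f) ^ 2 ≤ 0 := by
    refine ge_of_tendsto tendsto_inv_atTop_nhds_zero_nat ?_
    filter_upwards [eventually_ne_atTop 0] with J hJ using key J hJ
  exact pow_eq_zero_iff two_ne_zero |>.1 (le_antisymm hlim (sq_nonneg _))

end VanDerCorput

/-! ### PET induction -/

section PET

variable {A B : Type} [AddCommGroup A] [AddCommGroup B]

/-- The differences of the members of the family `p` with `p b` have degree at most `D`, with
equality for `p m`, and no other member of `p` differs from `p m` by a constant. -/
structure IsPETFamily {ι : Type} (D : ℕ) (p : ι → A → B) (b m : ι) : Prop where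
  mem : ∀ i, p i - p b ∈ polyLT A B (D + 1)
  notMem : p m - p b ∉ polyLT A B D
  ne : ∀ i, i ≠ m → p m - p i ∉ polyLT A B 1

/-- The classes, up to degree less than `e`, of the differences of degree `e` of members of the
family `p` with `p b`. -/
def leadingClasses {ι : Type} (p : ι → A → B) (b : ι) (e : ℕ) : Set ((A → B) ⧸ polyLT A B e) :=
  {c | c ≠ 0 ∧ ∃ i, p i - p b ∈ polyLT A B (e + 1) ∧ QuotientAddGroup.mk (p i - p b) = c}

lemma leadingClasses_subset_range {ι : Type} (p : ι → A → B) (b : ι) (e : ℕ) :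
    leadingClasses p b e ⊆ Set.range fun i => QuotientAddGroup.mk (p i - p b) := by
  rintro c ⟨-, i, -, rfl⟩
  exact ⟨i, rfl⟩

lemma finite_leadingClasses {ι : Type} [Finite ι] (p : ι → A → B) (b : ι) (e : ℕ) :
    (leadingClasses p b e).Finite :=
  (Set.finite_range _).subset (leadingClasses_subset_range p b e)

lemma ncard_leadingClasses_le {ι : Type} [Fintype ι] (p : ι → A → B) (b : ι) (e : ℕ) :
    (leadingClasses p b e).ncard ≤ Fintype.card ι := by
  refine (Set.ncard_le_ncard (leadingClasses_subset_range p b e) (Set.finite_range _)).trans ?_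
  rw [← Set.image_univ, ← Nat.card_eq_fintype_card, ← Set.ncard_univ]
  exact Set.ncard_image_le Set.finite_univ

/-- For a polynomial map `q` of degree `k + 2` there is a direction `v` such that the
differences of `q` along multiples of `v` avoid finitely many given classes. -/
lemma exists_diff_add_notMem [IsAddTorsionFree B] {ι : Type} [Finite ι] {k : ℕ} {q : A → B}
    (hq : q ∈ polyLT A B (k + 3)) (hq' : q ∉ polyLT A B (k + 2)) (r : ι → A → B) :
    ∃ v : A, ∀ c : ℤ, c ≠ 0 → ∀ i, (fun u => q (u + c • v) - q u + r i u) ∉ polyLT A B (k + 1) := by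
  rw [mem_polyLT_succ] at hq'
  push Not at hq'
  obtain ⟨v, hv⟩ := hq'
  set δ : A → B := fun u => q (u + v) - q u with hδ
  -- For each `i` at most one `c` is bad: two of them would put a nonzero multiple of `δ`, hence `δ`
  -- itself, in `polyLT A B (k + 1)`. Stretching `v` by a factor larger than all bad values makes
  -- every nonzero multiple good.
  let bad : Set ℤ := ⋃ i, {c : ℤ | c • δ + r i ∈ polyLT A B (k + 1)}
  have hbad : bad.Finite := by
    refine Set.finite_iUnion fun i => Set.Subsingleton.finite fun c hc c' hc' => ?_
    by_contra hne
    refine hv ((zsmul_mem_polyLT_iff (sub_ne_zero.2 hne)).1 ?_)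
    have : c • δ + r i - (c' • δ + r i) ∈ polyLT A B (k + 1) := sub_mem hc hc'
    rwa [add_sub_add_right_eq_sub, ← sub_smul] at this
  obtain ⟨N, hN⟩ : ∃ N : ℕ, ∀ c ∈ bad, c.natAbs < N := by
    obtain ⟨N, hN⟩ := (hbad.image Int.natAbs).bddAbove
    exact ⟨N + 1, fun c hc => Nat.lt_succ_of_le (hN ⟨c, hc, rfl⟩)⟩
  refine ⟨((N + 1 : ℕ) : ℤ) • v, fun c hc i hmem => ?_⟩
  -- Up to degree less than `k + 1`, the difference along a multiple of `v` is that multiple of `δ`.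
  have h1 := diff_zsmul_mem_polyLT (n := k + 1) hq v (c * ((N + 1 : ℕ) : ℤ))
  have h2 : c * ((N + 1 : ℕ) : ℤ) ∈ bad := by
    refine Set.mem_iUnion.2 ⟨i, ?_⟩
    have := sub_mem hmem h1
    refine (congrArg (· ∈ polyLT A B (k + 1)) ?_).mp this
    ext u
    simp only [Pi.sub_apply, Pi.add_apply, Pi.smul_apply, smul_smul, hδ]
    abel
  have h3 := hN _ h2
  rw [Int.natAbs_mul, Int.natAbs_natCast] at h3
  have h4 : 0 < c.natAbs := Int.natAbs_pos.2 hc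
  nlinarith

variable {ι : Type} {p : ι → A → B} {b : ι}

lemma vdcFamily_sub (h h' : A) (x y : Nonconst p b × Bool) :
    vdcFamily p b h h' x - vdcFamily p b h h' y =
      fun u => (p x.1 - p b) (u + if x.2 then h else h') -
        (p y.1 - p b) (u + if y.2 then h else h') := rfl

/-- The van der Corput operation does not increase the number of classes of a degree larger than
that of the next base. -/
lemma leadingClasses_vdcFamily_subset {j : Nonconst p b} {e e' : ℕ}
    (hj : p j - p b ∈ polyLT A B (e + 1)) (he : e < e') (h h' : A) :
    leadingClasses (vdcFamily p b h h') (j, true) e' ⊆ leadingClasses p b e' := by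
  rintro c ⟨hc, ⟨s, t⟩, hmem, rfl⟩
  rw [vdcFamily_sub] at hmem hc ⊢
  -- The new base has degree less than `e'`, so it is invisible in the classes of degree `e'`;
  -- shifts only change lower order terms.
  have hj' : (fun u => (p j - p b) (u + h)) ∈ polyLT A B e' :=
    translate_mem_polyLT (polyLT_mono he hj) h
  have h1 : (fun u => (p s - p b) (u + if t then h else h')) ∈ polyLT A B (e' + 1) := by
    have := add_mem hmem (polyLT_le_succ _ hj')
    refine (congrArg (· ∈ polyLT A B (e' + 1)) ?_).mp this
    ext u
    simp
  have h2 : p s - p b ∈ polyLT A B (e' + 1) := (translate_mem_polyLT_iff _).1 h1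
  refine ⟨hc, s, h2, ?_⟩
  rw [QuotientAddGroup.eq]
  have := sub_mem (mem_polyLT_succ.1 h2 (if t then h else h')) hj'
  refine (congrArg (· ∈ polyLT A B e') ?_).mp this
  ext u
  simp only [Pi.sub_apply, Pi.add_apply, Pi.neg_apply, if_true]
  abel

/-- The van der Corput operation decreases the number of classes of minimal degree. -/
lemma ncard_leadingClasses_vdcFamily_lt [Finite ι] {j : Nonconst p b} {e : ℕ}
    (hj : p j - p b ∈ polyLT A B (e + 1)) (hmin : ∀ i : Nonconst p b, p i - p b ∉ polyLT A B e)
    (h h' : A) :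
    (leadingClasses (vdcFamily p b h h') (j, true) e).ncard < (leadingClasses p b e).ncard := by
  set x : (A → B) ⧸ polyLT A B e := QuotientAddGroup.mk (p j - p b) with hx
  have hmem : x ∈ leadingClasses p b e :=
    ⟨fun h0 => hmin j ((QuotientAddGroup.eq_zero_iff _).1 h0), j, hj, rfl⟩
  -- Shifts do not affect the classes of degree `e`, so passing to the base `j` subtracts `x` from
  -- each of them. The class `x` becomes zero and is no longer counted; by minimality of `e` there
  -- are no new classes.
  have hsub : leadingClasses (vdcFamily p b h h') (j, true) e ⊆
      (fun c => c - x) '' (leadingClasses p b e \ {x}) := by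
    rintro c ⟨hc, ⟨s, t⟩, hmem, rfl⟩
    rw [vdcFamily_sub] at hmem hc ⊢
    have h1 : (fun u => (p s - p b) (u + if t then h else h')) ∈ polyLT A B (e + 1) := by
      have := add_mem hmem (translate_mem_polyLT hj h)
      refine (congrArg (· ∈ polyLT A B (e + 1)) ?_).mp this
      ext u
      simp
    have h2 : p s - p b ∈ polyLT A B (e + 1) := (translate_mem_polyLT_iff _).1 h1
    have h3 : (QuotientAddGroup.mk (fun u => (p s - p b) (u + if t then h else h') -
        (p j - p b) (u + if true then h else h')) : (A → B) ⧸ polyLT A B e) =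
        QuotientAddGroup.mk (p s - p b) - x := by
      rw [hx, ← QuotientAddGroup.mk_sub, QuotientAddGroup.eq]
      have := sub_mem (mem_polyLT_succ.1 hj h)
        (mem_polyLT_succ.1 h2 (if t then h else h'))
      refine (congrArg (· ∈ polyLT A B e) ?_).mp this
      ext u
      simp only [Pi.sub_apply, Pi.add_apply, Pi.neg_apply, if_true]
      abel
    rw [h3] at hc
    refine ⟨QuotientAddGroup.mk (p s - p b), ⟨⟨fun h0 => hmin s
      ((QuotientAddGroup.eq_zero_iff _).1 h0), s, h2, rfl⟩, fun h0 => hc ?_⟩, h3.symm⟩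
    rw [Set.mem_singleton_iff.1 h0, sub_self]
  have hfin := finite_leadingClasses p b e
  refine (Set.ncard_le_ncard hsub (hfin.sdiff.image _)).trans_lt ?_
  refine (Set.ncard_image_le hfin.sdiff).trans_lt ?_
  exact Set.ncard_sdiff_singleton_lt_of_mem hmem hfin

/-- One step of the PET induction. -/
lemma IsPETFamily.exists_vdcFamily [IsAddTorsionFree B] [Finite ι] {k : ℕ} {m : ι}
    (hp : IsPETFamily (k + 2) p b m) :
    ∃ (hm : p m - p b ∉ polyLT A B 1) (h : ℕ → A) (j : Nonconst p b) (e D : ℕ),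
      1 ≤ e ∧ e ≤ k + 2 ∧ 1 ≤ D ∧ D ≤ k + 2 ∧ ∀ i i', i ≠ i' →
        IsPETFamily D (vdcFamily p b (h i) (h i')) (j, true) (⟨m, hm⟩, false) ∧
        (∀ e', e < e' → (leadingClasses (vdcFamily p b (h i) (h i')) (j, true) e').ncard ≤
          (leadingClasses p b e').ncard) ∧
        (leadingClasses (vdcFamily p b (h i) (h i')) (j, true) e).ncard <
          (leadingClasses p b e).ncard := by
  classical
  have hm : p m - p b ∉ polyLT A B 1 := fun h => hp.notMem (polyLT_mono (by omega) h)
  -- The next base will be a member of least degree `e` among those at nonconstant distance from `p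
  -- b`.
  have hex : ∃ e, ∃ s : Nonconst p b, p s - p b ∈ polyLT A B (e + 1) :=
    ⟨k + 2, ⟨m, hm⟩, hp.mem m⟩
  set e := Nat.find hex with he
  have hmin : ∀ s : Nonconst p b, p s - p b ∉ polyLT A B e := by
    intro s hs
    rcases hcase : e with _ | e'
    · rw [hcase] at hs
      exact s.2 (polyLT_le_succ 0 hs)
    · rw [hcase] at hs
      exact Nat.find_min hex (m := e') (by omega) ⟨s, hs⟩
  have he1 : 1 ≤ e := by
    by_contra h0
    obtain ⟨s, hs⟩ := Nat.find_spec hex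
    rw [← he, show e = 0 by omega] at hs
    exact s.2 hs
  have heD : e ≤ k + 2 := Nat.find_min' hex ⟨⟨m, hm⟩, hp.mem m⟩
  -- When a copy of `p m` and a copy of `p s` with different shifts are compared, the result is,
  -- after a translation, a difference of `p m - p b` plus `p m - p s`; this dictates the terms to
  -- be avoided.
  obtain ⟨v, hv⟩ := exists_diff_add_notMem (hp.mem m) hp.notMem (fun i => p m - p i)
  have hgen : ∀ (i i' : ℕ), i ≠ i' → ∀ s : ι,
      (fun u => (p m - p b) (u + i' • v) - (p s - p b) (u + i • v)) ∉ polyLT A B (k + 1) := by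
    intro i i' hii s
    have h1 := hv ((i' : ℤ) - i) (sub_ne_zero.2 (by exact_mod_cast hii.symm)) s
    rw [← translate_mem_polyLT_iff (i • v)] at h1
    refine fun h => h1 ((congrArg (· ∈ polyLT A B (k + 1)) ?_).mp h)
    ext u
    simp only [sub_smul, natCast_zsmul, Pi.sub_apply]
    rw [show u + i • v + (i' • v - i • v) = u + i' • v by abel]
    abel
  have hne : ∀ (i i' : ℕ), i ≠ i' → ∀ x : Nonconst p b × Bool, x ≠ (⟨m, hm⟩, false) →
      vdcFamily p b (i • v) (i' • v) (⟨m, hm⟩, false) - vdcFamily p b (i • v) (i' • v) x ∉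
        polyLT A B 1 := by
    rintro i i' hii ⟨s, t⟩ hx
    rw [vdcFamily_sub]
    cases t
    · have hs : (s : ι) ≠ m := fun h => hx (by rw [Prod.mk.injEq]; exact ⟨Subtype.ext h, rfl⟩)
      have := hp.ne s hs
      rw [← translate_mem_polyLT_iff (i' • v)] at this
      refine fun h => this ((congrArg (· ∈ polyLT A B 1) ?_).mp h)
      ext u
      simp
    · exact fun h => hgen i i' hii s (polyLT_mono (by omega) h)
  -- Preferably `j` is such that `p m - p j` keeps the degree `k + 2`. If no member of least degree
  -- is of this kind, then `e = k + 2`, since otherwise `p m - p b` would have smaller degree; so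
  -- all members of `Nonconst p b` have the same leading part as `p m`. Then `m` itself serves as
  -- base and the degree drops to exactly `k + 1`.
  obtain ⟨j, hj, hcase⟩ : ∃ j : Nonconst p b, p j - p b ∈ polyLT A B (e + 1) ∧
      ((p m - p b) - (p j - p b) ∉ polyLT A B (k + 2) ∨
        (j = ⟨m, hm⟩ ∧ ∀ s : Nonconst p b, (p s - p b) - (p m - p b) ∈ polyLT A B (k + 2))) := by
    by_cases hA : ∃ j : Nonconst p b, p j - p b ∈ polyLT A B (e + 1) ∧
      (p m - p b) - (p j - p b) ∉ polyLT A B (k + 2)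
    · obtain ⟨j, hj, hj'⟩ := hA
      exact ⟨j, hj, Or.inl hj'⟩
    · push Not at hA
      obtain ⟨s, hs⟩ := Nat.find_spec hex
      have heq : e = k + 2 := by
        by_contra hlt
        refine hp.notMem ?_
        have h1 := add_mem (hA s hs) (polyLT_mono (show e + 1 ≤ k + 2 by omega) hs)
        rwa [sub_add_cancel] at h1
      refine ⟨⟨m, hm⟩, by rw [heq]; exact hp.mem m, Or.inr ⟨rfl, fun s => ?_⟩⟩
      exact polyLT_sub_comm (hA s (by rw [heq]; exact hp.mem s))
  rcases hcase with hA | ⟨rfl, hB⟩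
  · refine ⟨hm, fun i => i • v, j, e, k + 2, he1, heD, by omega, le_rfl, fun i i' hii =>
      ⟨⟨fun x => ?_, ?_, hne i i' hii⟩, fun e' hee => Set.ncard_le_ncard
        (leadingClasses_vdcFamily_subset hj hee _ _) (finite_leadingClasses _ _ _),
        ncard_leadingClasses_vdcFamily_lt hj hmin _ _⟩⟩
    · rw [vdcFamily_sub]
      exact sub_mem (translate_mem_polyLT (hp.mem _) _) (translate_mem_polyLT (hp.mem _) _)
    · rw [vdcFamily_sub]
      intro h
      refine hA ?_
      have h1 := mem_polyLT_succ.1 (hp.mem m) (i' • v)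
      have h2 := mem_polyLT_succ.1 (hp.mem j) (i • v)
      refine (congrArg (· ∈ polyLT A B (k + 2)) ?_).mp (add_mem (sub_mem h h1) h2)
      ext u
      simp only [Pi.sub_apply, Pi.add_apply, if_true, Bool.false_eq_true, if_false]
      abel
  · refine ⟨hm, fun i => i • v, ⟨m, hm⟩, e, k + 1, he1, heD, by omega, by omega, fun i i' hii =>
      ⟨⟨fun x => ?_, ?_, hne i i' hii⟩, fun e' hee => Set.ncard_le_ncard
        (leadingClasses_vdcFamily_subset hj hee _ _) (finite_leadingClasses _ _ _),
        ncard_leadingClasses_vdcFamily_lt hj hmin _ _⟩⟩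
    · rw [vdcFamily_sub]
      have h1 := translate_mem_polyLT (hB x.1) (if x.2 then i • v else i' • v)
      have h2 := mem_polyLT_succ.1 (hp.mem m) (if x.2 then i • v else i' • v)
      have h3 := mem_polyLT_succ.1 (hp.mem m) (i • v)
      refine (congrArg (· ∈ polyLT A B (k + 2)) ?_).mp (sub_mem (add_mem h1 h2) h3)
      ext u
      simp only [Pi.sub_apply, Pi.add_apply, if_true]
      abel
    · exact hgen i i' hii m

/-- The first coordinate at which a strict decrease occurs is at most `a`, and all coordinates
before it are equal. -/
lemma toLex_lt_of_le {n : ℕ} {w w' : Fin n → ℕ} (a : Fin n) (h : ∀ a' < a, w' a' ≤ w a')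
    (ha : w' a < w a) : toLex w' < toLex w := by
  classical
  have hex : ∃ k : ℕ, ∃ hk : k < n, w' ⟨k, hk⟩ < w ⟨k, hk⟩ := ⟨a, a.2, ha⟩
  obtain ⟨hk, hlt⟩ := Nat.find_spec hex
  refine ⟨⟨Nat.find hex, hk⟩, fun a' ha' => ?_, hlt⟩
  have h1 : (a' : ℕ) < Nat.find hex := ha'
  have h2 : ¬ w' a' < w a' := fun hl => Nat.find_min hex h1 ⟨a'.2, hl⟩
  exact le_antisymm (h a' (lt_of_lt_of_le ha' (Nat.find_min' hex ⟨a.2, ha⟩))) (not_lt.1 h2)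

/-- The weight of a family: the numbers of classes of degree `D, D - 1, …, 1`. -/
noncomputable def petWeight {ι : Type} (D : ℕ) (p : ι → A → B) (b : ι) : Fin D → ℕ :=
  fun a => (leadingClasses p b (D - a)).ncard

/-- Well-founded induction on the weight. The order `K` must serve all families with at most `N`
members and the given weight, because the families produced by the van der Corput operation vary
with the shifts. -/
lemma exists_controlled_of_weight [IsAddTorsionFree B] (D₀ : ℕ) (w : Lex (Fin D₀ → ℕ)) :
    ∀ N : ℕ, ∃ K : ℕ, ∀ (ι : Type) [Fintype ι] (p : ι → A → B) (b m : ι) (D : ℕ),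
      Fintype.card ι ≤ N → 1 ≤ D → D ≤ D₀ → IsPETFamily D p b m →
        toLex (petWeight D₀ p b) = w → Controlled.{u} K p m := by
  classical
  induction w using WellFoundedLT.induction with
  | ind w ih =>
    intro N
    choose K hK using fun (w' : Lex (Fin D₀ → ℕ)) (hw : w' < w) => ih w' hw (N * 2)
    -- A new family has at most `2N` members, so the entries of its weight are at most `2N`. The
    -- supremum over these finitely many weights covers the induction step, and `N` covers the
    -- linear case.
    let W : Finset (Fin D₀ → ℕ) := Fintype.piFinset fun _ => Finset.range (N * 2 + 1)
    let K' : (Fin D₀ → ℕ) → ℕ := fun w' => if hw : toLex w' < w then K (toLex w') hw else 0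
    refine ⟨max N (W.sup K'), fun ι _ p b m D hN hD1 hD hp hw => ?_⟩
    obtain rfl | ⟨k, rfl⟩ : D = 1 ∨ ∃ k, D = k + 2 := by
      rcases D with _ | _ | k
      · omega
      · exact Or.inl rfl
      · exact Or.inr ⟨k, rfl⟩
    · refine (Controlled.of_linear (b := b) ?_ ?_ hp.ne).mono (hN.trans (le_max_left _ _))
      · rintro rfl
        exact hp.notMem (by rw [sub_self]; exact zero_mem _)
      · intro i j
        have := sub_mem (hp.mem i) (hp.mem j)
        rwa [sub_sub_sub_cancel_right] at this
    · obtain ⟨hm, h, j, e, D, he1, heD, hD1', hD', H⟩ := hp.exists_vdcFamily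
      refine Controlled.of_vdcFamily hm h fun i i' hii => ?_
      obtain ⟨hp', hle, hlt⟩ := H i i' hii
      set w' := petWeight D₀ (vdcFamily p b (h i) (h i')) (j, true) with hw'
      have hcard : Fintype.card (Nonconst p b × Bool) ≤ N * 2 := by
        rw [Fintype.card_prod, Fintype.card_bool]
        exact Nat.mul_le_mul_right _ ((Fintype.card_subtype_le _).trans hN)
      have hww : toLex w' < w := by
        rw [← hw]
        -- Coordinate `D₀ - e` counts the classes of degree `e`, and earlier coordinates those of
        -- larger degree.
        refine toLex_lt_of_le ⟨D₀ - e, by omega⟩ (fun a ha => ?_) ?_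
        · have ha' : (a : ℕ) < D₀ - e := ha
          exact hle _ (by omega)
        · simp only [hw', petWeight]
          rw [show D₀ - (D₀ - e) = e by omega]
          exact hlt
      have hmem : w' ∈ W := by
        rw [Fintype.mem_piFinset]
        intro a
        rw [Finset.mem_range, Nat.lt_succ_iff]
        exact (ncard_leadingClasses_le _ _ _).trans hcard
      refine (hK (toLex w') hww _ _ _ _ D hcard hD1' (hD'.trans hD) hp' rfl).mono ?_
      refine le_trans ?_ (le_max_right _ _)
      have : K' w' = K (toLex w') hww := dif_pos hww
      rw [← this]
      exact Finset.le_sup hmem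

/-- A family of polynomial maps none of which differs from `p m` by a constant is controlled by a
uniformity seminorm of the function with index `m`. -/
theorem exists_controlled [IsAddTorsionFree B] {ι : Type} [Fintype ι] [Nontrivial ι]
    {p : ι → A → B} (hp : ∀ i, ∃ n, p i ∈ polyLT A B n) {m : ι}
    (hm : ∀ i, i ≠ m → p m - p i ∉ polyLT A B 1) : ∃ K, Controlled.{u} K p m := by
  classical
  choose n hn using hp
  have hex : ∃ D, ∀ i, p i - p m ∈ polyLT A B (D + 1) :=
    ⟨Finset.univ.sup n, fun i => sub_mem
      (polyLT_mono ((Finset.le_sup (Finset.mem_univ i)).trans (Nat.le_succ _)) (hn i))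
      (polyLT_mono ((Finset.le_sup (Finset.mem_univ m)).trans (Nat.le_succ _)) (hn m))⟩
  set D := Nat.find hex with hD
  have hmem := Nat.find_spec hex
  rw [← hD] at hmem
  have hD1 : 1 ≤ D := by
    obtain ⟨i, hi⟩ := exists_ne m
    by_contra h0
    rw [show D = 0 by omega] at hmem
    exact hm i hi (polyLT_sub_comm (hmem i))
  -- The base is a member for which the maximal degree `D` of the differences with `p m` is
  -- attained.
  obtain ⟨b, hb⟩ : ∃ b, p b - p m ∉ polyLT A B D := by
    by_contra hcon
    push Not at hcon
    refine Nat.find_min hex (m := D - 1) (by omega) fun i => ?_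
    rw [Nat.sub_add_cancel hD1]
    exact hcon i
  have hPET : IsPETFamily D p b m := by
    refine ⟨fun i => ?_, fun h => hb (polyLT_sub_comm h), hm⟩
    have := sub_mem (hmem i) (hmem b)
    rwa [sub_sub_sub_cancel_right] at this
  obtain ⟨K, hK⟩ := exists_controlled_of_weight.{u} (A := A) (B := B) D
    (toLex (petWeight D p b)) (Fintype.card ι)
  exact ⟨K, hK ι p b m D le_rfl hD1 le_rfl hPET rfl⟩

end PET

/-! ### The mean ergodic theorem and conditional expectations -/

section MeanErgodic

variable {Y : Type*} [mY : MeasurableSpace Y] {m : Measure Y} {S : Y → Y}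

/-- The Koopman operator on `L²`. -/
noncomputable def koopman (hS : MeasurePreserving S m m) : Lp ℝ 2 m →L[ℝ] Lp ℝ 2 m :=
  (Lp.compMeasurePreservingₗᵢ ℝ S hS).toContinuousLinearMap

lemma norm_koopman_le (hS : MeasurePreserving S m m) : ‖koopman hS‖ ≤ 1 :=
  LinearIsometry.norm_toContinuousLinearMap_le _

lemma inner_koopman (hS : MeasurePreserving S m m) (g h : Lp ℝ 2 m) :
    inner ℝ (koopman hS g) (koopman hS h) = inner ℝ g h :=
  (Lp.compMeasurePreservingₗᵢ ℝ S hS).inner_map_map g h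

lemma koopman_iterate_toLp (hS : MeasurePreserving S m m) {F : Y → ℝ} (hF : MemLp F 2 m) (n : ℕ) :
    (koopman hS)^[n] (hF.toLp F) = (hF.comp_measurePreserving (hS.iterate n)).toLp _ := by
  have := congrFun (Lp.compMeasurePreserving_iterate (E := ℝ) (p := 2) hS n) (hF.toLp F)
  exact this

/-- The limsup of `g` along the orbit is strictly invariant, and it agrees with `g` wherever `g` is
constant on the forward orbit, thus almost everywhere. -/
lemma ae_eq_of_comp_ae_eq (hS : MeasurePreserving S m m) {g : Y → ℝ} (hg : Measurable g)
    (h : g ∘ S =ᵐ[m] g) : ∃ g' : Y → ℝ, Measurable[MeasurableSpace.invariants S] g' ∧ g =ᵐ[m] g' := by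
  have hit : ∀ n, g ∘ S^[n] =ᵐ[m] g := by
    intro n
    induction n with
    | zero => rfl
    | succ n ih =>
      rw [Function.iterate_succ, ← Function.comp_assoc]
      exact (hS.quasiMeasurePreserving.ae_eq_comp ih).trans h
  refine ⟨fun x => limsup (fun n => g (S^[n] x)) atTop, ?_, ?_⟩
  · refine MeasurableSpace.measurable_invariants_dom.2
      ⟨Measurable.limsup fun n => hg.comp (hS.measurable.iterate n), fun s _ => ?_⟩
    congr 1
    ext x
    have := limsup_nat_add (fun n => g (S^[n] x)) 1
    simpa [Function.iterate_succ_apply] using this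
  · filter_upwards [ae_all_iff.2 hit] with x hx
    simp only [Function.comp_apply] at hx
    simp [hx]

/-- The identification of the fixed space turns the projection in von Neumann's theorem into the
conditional expectation on the strictly invariant sets. -/
lemma eqLocus_koopman (hS : MeasurePreserving S m m) :
    (koopman hS).eqLocus (1 : Lp ℝ 2 m →L[ℝ] Lp ℝ 2 m) =
      lpMeas ℝ ℝ (MeasurableSpace.invariants S) 2 m := by
  ext g
  rw [mem_lpMeas_iff_aestronglyMeasurable]
  have h1 : g ∈ (koopman hS).eqLocus (1 : Lp ℝ 2 m →L[ℝ] Lp ℝ 2 m) ↔ g ∘ S =ᵐ[m] g := by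
    change Lp.compMeasurePreserving S hS g = g ↔ _
    rw [Lp.ext_iff]
    have := Lp.coeFn_compMeasurePreserving g hS
    exact ⟨fun h => this.symm.trans h, fun h => this.trans h⟩
  rw [h1]
  constructor
  · intro h
    obtain ⟨g', hg', hgg'⟩ := ae_eq_of_comp_ae_eq hS (Lp.stronglyMeasurable g).measurable h
    exact ⟨g', hg'.stronglyMeasurable, hgg'⟩
  · rintro ⟨g', hg', hgg'⟩
    have h2 := hS.quasiMeasurePreserving.ae_eq_comp hgg'
    rw [MeasurableSpace.comp_eq_of_measurable_invariants hg'.measurable] at h2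
    exact h2.trans hgg'.symm

lemma coe_orthogonalProjectionOnto_congr {E : Type*} [NormedAddCommGroup E] [InnerProductSpace ℝ E]
    {U V : Submodule ℝ E} [U.HasOrthogonalProjection] [V.HasOrthogonalProjection] (h : U = V)
    (x : E) : (U.orthogonalProjectionOnto x : E) = V.orthogonalProjectionOnto x := by
  subst h
  rfl

lemma tendsto_birkhoffAverage_koopman (hS : MeasurePreserving S m m) {F : Y → ℝ}
    (hF : MemLp F 2 m) :
    Tendsto (fun J => birkhoffAverage ℝ (koopman hS) _root_.id J (hF.toLp F)) atTop
      (𝓝 (condExpL2 ℝ ℝ (MeasurableSpace.invariants_le S) (hF.toLp F) : Lp ℝ 2 m)) := by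
  have h := ContinuousLinearMap.tendsto_birkhoffAverage_orthogonalProjection (koopman hS)
    (norm_koopman_le hS) (hF.toLp F)
  have : Fact (MeasurableSpace.invariants S ≤ mY) := ⟨MeasurableSpace.invariants_le S⟩
  rwa [coe_orthogonalProjectionOnto_congr (eqLocus_koopman hS)] at h

lemma inner_birkhoffAverage_koopman (hS : MeasurePreserving S m m) {F G : Y → ℝ}
    (hF : MemLp F 2 m) (hG : MemLp G 2 m) (J : ℕ) :
    inner ℝ (birkhoffAverage ℝ (koopman hS) _root_.id J (hF.toLp F))
      (birkhoffAverage ℝ (koopman hS) _root_.id J (hG.toLp G)) =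
      ((J : ℝ) ^ 2)⁻¹ * ∑ i ∈ Finset.range J, ∑ j ∈ Finset.range J,
        ∫ y, F (S^[i] y) * G (S^[j] y) ∂m := by
  simp only [birkhoffAverage, birkhoffSum, id, koopman_iterate_toLp]
  rw [real_inner_smul_left, real_inner_smul_right, ← mul_assoc, sq, mul_inv]
  rw [sum_inner]
  simp only [inner_sum]
  congr 1
  refine Finset.sum_congr rfl fun i _ => Finset.sum_congr rfl fun j _ => ?_
  rw [L2.inner_def]
  refine integral_congr_ae ?_
  filter_upwards [(hF.comp_measurePreserving (hS.iterate i)).coeFn_toLp,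
    (hG.comp_measurePreserving (hS.iterate j)).coeFn_toLp] with y h1 h2
  rw [h1, h2]
  simp [mul_comm]

variable [IsProbabilityMeasure m]

lemma inner_condExpL2 {I : MeasurableSpace Y} (hI : I ≤ mY) {F G : Y → ℝ}
    (hF : MemLp F 2 m) (hG : MemLp G 2 m) :
    inner ℝ (condExpL2 ℝ ℝ hI (hF.toLp F) : Lp ℝ 2 m) (condExpL2 ℝ ℝ hI (hG.toLp G) : Lp ℝ 2 m) =
      ∫ y, (m[F|I]) y * (m[G|I]) y ∂m := by
  rw [L2.inner_def]
  refine integral_congr_ae ?_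
  filter_upwards [hF.condExpL2_ae_eq_condExp (𝕜 := ℝ) hI, hG.condExpL2_ae_eq_condExp (𝕜 := ℝ) hI]
    with y h1 h2
  rw [h1, h2]
  simp [mul_comm]

/-- The mean ergodic theorem, for the correlation of two averages. -/
lemma tendsto_average_correlation (hS : MeasurePreserving S m m) {F G : Y → ℝ}
    (hF : MemLp F 2 m) (hG : MemLp G 2 m) :
    Tendsto (fun J : ℕ => ((J : ℝ) ^ 2)⁻¹ * ∑ i ∈ Finset.range J, ∑ j ∈ Finset.range J,
        ∫ y, F (S^[i] y) * G (S^[j] y) ∂m) atTop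
      (𝓝 (∫ y, (m[F|MeasurableSpace.invariants S]) y *
        (m[G|MeasurableSpace.invariants S]) y ∂m)) := by
  rw [← inner_condExpL2 (MeasurableSpace.invariants_le S) hF hG]
  simp only [← inner_birkhoffAverage_koopman hS hF hG]
  exact (tendsto_birkhoffAverage_koopman hS hF).inner (tendsto_birkhoffAverage_koopman hS hG)

/-- The average `a` of the orbit of `F` has the same projection `P` to the fixed vectors as `F`,
whence `‖P‖ ^ 2 ≤ ‖a‖ ^ 2`. So the limit in the mean ergodic theorem is a lower bound for every
finite average; this permits the exchange of limits in `iterated_limits_eq`. -/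
lemma integral_condExp_mul_le_average (hS : MeasurePreserving S m m) {F : Y → ℝ}
    (hF : MemLp F 2 m) {J : ℕ} (hJ : J ≠ 0) :
    ∫ y, (m[F|MeasurableSpace.invariants S]) y * (m[F|MeasurableSpace.invariants S]) y ∂m ≤
      ((J : ℝ) ^ 2)⁻¹ * ∑ i ∈ Finset.range J, ∑ j ∈ Finset.range J,
        ∫ y, F (S^[i] y) * F (S^[j] y) ∂m := by
  rw [← inner_condExpL2 (MeasurableSpace.invariants_le S) hF hF,
    ← inner_birkhoffAverage_koopman hS hF hF]
  set x := hF.toLp F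
  set P : Lp ℝ 2 m := (condExpL2 ℝ ℝ (MeasurableSpace.invariants_le S) x : Lp ℝ 2 m) with hP
  have hfix : ∀ i, (koopman hS)^[i] P = P := by
    have : P ∈ (koopman hS).eqLocus (1 : Lp ℝ 2 m →L[ℝ] Lp ℝ 2 m) := by
      rw [eqLocus_koopman]
      exact (condExpL2 ℝ ℝ (MeasurableSpace.invariants_le S) x).2
    exact fun i => Function.iterate_fixed this i
  have hinv : ∀ i (y z : Lp ℝ 2 m), inner ℝ ((koopman hS)^[i] y) ((koopman hS)^[i] z) =
      inner ℝ y z := by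
    intro i
    induction i with
    | zero => simp
    | succ i ih =>
      intro y z
      rw [Function.iterate_succ_apply', Function.iterate_succ_apply', inner_koopman, ih]
  have hPx : ∀ J : ℕ, J ≠ 0 →
      inner ℝ P (birkhoffAverage ℝ (koopman hS) _root_.id J x) = inner ℝ P x := by
    intro J hJ
    have hJ' : (J : ℝ) ≠ 0 := Nat.cast_ne_zero.2 hJ
    have h1 : ∀ i, inner ℝ P ((koopman hS)^[i] x) = inner ℝ P x := fun i => by
      conv_lhs => rw [← hfix i]
      exact hinv i P x
    simp only [birkhoffAverage, birkhoffSum, id, inner_smul_right, inner_sum, h1, Finset.sum_const,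
      Finset.card_range, nsmul_eq_mul]
    field_simp
  have hPP : inner ℝ P x = inner ℝ P P := by
    refine tendsto_nhds_unique ?_
      ((tendsto_const_nhds (x := P)).inner (tendsto_birkhoffAverage_koopman hS hF))
    refine (tendsto_const_nhds (x := inner ℝ P x)).congr' ?_
    filter_upwards [eventually_ne_atTop 0] with J hJ using (hPx J hJ).symm
  set a := birkhoffAverage ℝ (koopman hS) _root_.id J x
  have h2 : inner ℝ P a = inner ℝ P P := (hPx J hJ).trans hPP
  have h3 := real_inner_self_nonneg (x := P - a)
  rw [inner_sub_left, inner_sub_right, inner_sub_right, real_inner_comm P a, h2] at h3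
  linarith

lemma condExp_invariants_of_ergodic (hS : Ergodic S m) {F : Y → ℝ} :
    m[F|MeasurableSpace.invariants S] =ᵐ[m] fun _ => ∫ y, F y ∂m := by
  have hmeas := (stronglyMeasurable_condExp (μ := m) (m := MeasurableSpace.invariants S)
    (f := F)).measurable
  obtain ⟨c, hc⟩ := hS.ae_eq_const_of_ae_eq_comp_ae
    (stronglyMeasurable_condExp.mono (MeasurableSpace.invariants_le S)).aestronglyMeasurable
    (ae_of_all _ (congrFun (MeasurableSpace.comp_eq_of_measurable_invariants hmeas)))
  have h1 := integral_condExp (μ := m) (f := F) (MeasurableSpace.invariants_le S)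
  rw [integral_congr_ae hc] at h1
  simp only [Function.const_apply, integral_const, probReal_univ, one_smul] at h1
  rw [← h1]
  exact hc

end MeanErgodic

/-! ### Diagonal maps on cubes -/

section Cube

variable {X : Type*}

lemma cubeMap_comp (S T : X → X) : ∀ (k : ℕ) (y : Cube X k),
    cubeMap S k (cubeMap T k y) = cubeMap (S ∘ T) k y
  | 0, _ => rfl
  | k + 1, y => Prod.ext (cubeMap_comp S T k y.1) (cubeMap_comp S T k y.2)

lemma cubeMap_id : ∀ (k : ℕ) (y : Cube X k), cubeMap _root_.id k y = y
  | 0, _ => rfl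
  | k + 1, y => Prod.ext (cubeMap_id k y.1) (cubeMap_id k y.2)

lemma cubeMap_iterate (S : X → X) (k i : ℕ) (y : Cube X k) :
    (cubeMap S k)^[i] y = cubeMap S^[i] k y := by
  induction i generalizing y with
  | zero => exact (cubeMap_id k y).symm
  | succ i ih => rw [Function.iterate_succ_apply, ih, cubeMap_comp, Function.iterate_succ]

lemma cubeProd_cubeMap (f : X → ℝ) (S : X → X) : ∀ (k : ℕ) (y : Cube X k),
    cubeProd f k (cubeMap S k y) = cubeProd (fun x => f (S x)) k y
  | 0, _ => rfl
  | k + 1, y => congrArg₂ (· * ·) (cubeProd_cubeMap f S k y.1) (cubeProd_cubeMap f S k y.2)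

lemma cubeProd_mul (f g : X → ℝ) : ∀ (k : ℕ) (y : Cube X k),
    cubeProd (fun x => f x * g x) k y = cubeProd f k y * cubeProd g k y
  | 0, _ => rfl
  | k + 1, y => by
    simp only [cubeProd, cubeProd_mul f g k]
    ring

lemma cubeProd_const_mul (c : ℝ) (f : X → ℝ) : ∀ (k : ℕ) (y : Cube X k),
    cubeProd (fun x => c * f x) k y = c ^ 2 ^ k * cubeProd f k y
  | 0, _ => by simp [cubeProd]
  | k + 1, y => by
    simp only [cubeProd, cubeProd_const_mul c f k]
    ring

variable [MeasurableSpace X]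

lemma measurable_cubeMap {S : X → X} (hS : Measurable S) : ∀ k, Measurable (cubeMap S k)
  | 0 => hS
  | k + 1 => (measurable_cubeMap hS k).prodMap (measurable_cubeMap hS k)

lemma UnitBounded.cubeProd {f : X → ℝ} (hf : UnitBounded f) : ∀ k, UnitBounded (cubeProd f k)
  | 0 => hf
  | k + 1 => ((hf.cubeProd k).comp measurable_fst).mul ((hf.cubeProd k).comp measurable_snd)

end Cube

/-! ### The Host–Kra measures -/

section HostKra

variable {X : Type*} [MeasurableSpace X] {μ : Measure X}

open Classical in
/-- The Host–Kra measure `μ_T^[k]`, if there is one. -/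
noncomputable def hostKraMeasure (μ : Measure X) (T : X → X) (k : ℕ) : Measure (Cube X k) :=
  if h : ∃ ν, IsHostKraMeasure μ T k ν then h.choose else 0

/-- A measure at level `K` contains, by its recursive definition, witnesses for all lower levels. -/
lemma isHostKraMeasure_hostKraMeasure {T : X → X} {K : ℕ} {ν : Measure (Cube X K)}
    (hν : IsHostKraMeasure μ T K ν) {k : ℕ} (hk : k ≤ K) :
    IsHostKraMeasure μ T k (hostKraMeasure μ T k) := by
  have hex : ∃ ν, IsHostKraMeasure μ T k ν := by
    induction hk using Nat.decreasingInduction with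
    | self => exact ⟨ν, hν⟩
    | of_succ k _ ih =>
      obtain ⟨_, m, hm, -⟩ := ih
      exact ⟨m, hm⟩
  rw [hostKraMeasure, dif_pos hex]
  exact hex.choose_spec

lemma isRelIndepSquare_hostKraMeasure [IsProbabilityMeasure μ] {T : X → X} {K : ℕ}
    {ν : Measure (Cube X K)} (hν : IsHostKraMeasure μ T K ν) {k : ℕ} (hk : k < K) :
    IsRelIndepSquare (MeasurableSpace.invariants (cubeMap T k)) (hostKraMeasure μ T k)
      (hostKraMeasure μ T (k + 1)) := by
  obtain ⟨m, hm, h⟩ := isHostKraMeasure_hostKraMeasure hν (Nat.succ_le_of_lt hk)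
  rwa [hm.unique (isHostKraMeasure_hostKraMeasure hν hk.le)] at h

/-- By the mean ergodic theorem `ν (s ×ˢ t)` is a limit of averages of `∫ 1_s (R^i y) 1_t (R^j y)
dm`. These do not change when `s` and `t` are replaced by their preimages under `S`, since `S`
commutes with `R` and preserves `m`. -/
lemma IsRelIndepSquare.measurePreserving_prodMap {Y : Type*} [MeasurableSpace Y] {m : Measure Y}
    [IsProbabilityMeasure m] {R S : Y → Y} (hR : MeasurePreserving R m m)
    (hS : MeasurePreserving S m m) (hRS : ∀ y, R (S y) = S (R y)) {ν : Measure (Y × Y)}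
    (hν : IsRelIndepSquare (MeasurableSpace.invariants R) m ν) :
    MeasurePreserving (Prod.map S S) ν ν := by
  have hprob := hν.isProbabilityMeasure (MeasurableSpace.invariants_le R)
  have hSm : Measurable (Prod.map S S) := hS.measurable.prodMap hS.measurable
  have hmap : IsProbabilityMeasure (ν.map (Prod.map S S)) :=
    Measure.isProbabilityMeasure_map hSm.aemeasurable
  refine ⟨hSm, Measure.ext_prod fun {s t} hs ht => ?_⟩
  rw [Measure.map_apply hSm (hs.prod ht), ← measureReal_eq_measureReal_iff]
  have hpre : Prod.map S S ⁻¹' (s ×ˢ t) = (S ⁻¹' s) ×ˢ (S ⁻¹' t) := rfl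
  rw [hpre]
  have key : ∀ {s t : Set Y}, MeasurableSet s → MeasurableSet t → ν.real (s ×ˢ t) =
      ∫ z, s.indicator (fun _ => (1 : ℝ)) z.1 * t.indicator (fun _ => (1 : ℝ)) z.2 ∂ν := by
    intro s t hs ht
    rw [← integral_indicator_one (hs.prod ht)]
    congr 1
    ext z
    by_cases h1 : z.1 ∈ s <;> by_cases h2 : z.2 ∈ t <;> simp [Set.indicator, h1, h2]
  have hmem : ∀ {s : Set Y}, MeasurableSet s → ∀ q, MemLp (s.indicator fun _ => (1 : ℝ)) q m :=
    fun hs q => memLp_indicator_const q hs 1 (by simp)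
  have hRi : ∀ i y, R^[i] (S y) = S (R^[i] y) := fun i y =>
    (Function.Commute.iterate_left (show Function.Commute R S from hRS) i) y
  rw [key hs ht, key (hS.measurable hs) (hS.measurable ht), hν _ _ (hmem hs _) (hmem ht _),
    hν _ _ (hmem (hS.measurable hs) _) (hmem (hS.measurable ht) _)]
  refine tendsto_nhds_unique (tendsto_average_correlation hR (hmem (hS.measurable hs) 2)
    (hmem (hS.measurable ht) 2)) ?_
  refine (tendsto_average_correlation hR (hmem hs 2) (hmem ht 2)).congr fun J => ?_
  congr 1
  refine Finset.sum_congr rfl fun i _ => Finset.sum_congr rfl fun j _ => ?_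
  have hmeas : Measurable fun y => s.indicator (fun _ => (1 : ℝ)) (R^[i] y) *
      t.indicator (fun _ => (1 : ℝ)) (R^[j] y) :=
    ((measurable_const.indicator hs).comp (hR.measurable.iterate i)).mul
      ((measurable_const.indicator ht).comp (hR.measurable.iterate j))
  conv_lhs => rw [← hS.map_eq]
  rw [integral_map hS.measurable.aemeasurable hmeas.aestronglyMeasurable]
  simp only [hRi]
  rfl

/-- Both maps go through the induction together: passing to the next level uses the mean ergodic
theorem for the diagonal map of `T`. -/
lemma IsHostKraMeasure.measurePreserving_cubeMap [IsProbabilityMeasure μ] {T S : X → X}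
    (hT : MeasurePreserving T μ μ) (hS : MeasurePreserving S μ μ) (hTS : ∀ x, T (S x) = S (T x)) :
    ∀ {k : ℕ} {ν : Measure (Cube X k)}, IsHostKraMeasure μ T k ν →
      MeasurePreserving (cubeMap T k) ν ν ∧ MeasurePreserving (cubeMap S k) ν ν
  | 0, _, h => by
    obtain rfl : _ = μ := h
    exact ⟨hT, hS⟩
  | k + 1, ν, ⟨m, hm, hν⟩ => by
    have := hm.isProbabilityMeasure
    obtain ⟨h1, h2⟩ := hm.measurePreserving_cubeMap hT hS hTS
    refine ⟨hν.measurePreserving_prodMap h1 h1 fun _ => rfl,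
      hν.measurePreserving_prodMap h1 h2 fun y => ?_⟩
    rw [cubeMap_comp, cubeMap_comp]
    congr 1
    exact funext hTS

lemma IsRelIndepSquare.map_fst_and_snd {Y : Type*} {I : MeasurableSpace Y} [mY : MeasurableSpace Y]
    {m : Measure Y} [IsProbabilityMeasure m] (hI : I ≤ mY) {ν : Measure (Y × Y)}
    (hν : IsRelIndepSquare I m ν) : ν.map Prod.fst = m ∧ ν.map Prod.snd = m := by
  have := hν.isProbabilityMeasure hI
  have hind : ∀ s : Set Y, MeasurableSet s → MemLp (s.indicator fun _ => (1 : ℝ)) ∞ m :=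
    fun s hs => memLp_indicator_const ∞ hs 1 (by simp)
  have hcond : ∀ s : Set Y, MeasurableSet s →
      ∫ y, (m[s.indicator fun _ => (1 : ℝ)|I]) y ∂m = m.real s := fun s hs => by
    rw [integral_condExp hI]
    exact integral_indicator_one hs
  constructor
  · have := Measure.isProbabilityMeasure_map (μ := ν) (measurable_fst (α := Y) (β := Y)).aemeasurable
    ext s hs
    rw [← measureReal_eq_measureReal_iff, map_measureReal_apply measurable_fst hs, ← hcond s hs,
      ← integral_indicator_one (measurable_fst hs)]
    have := hν _ (fun _ => 1) (hind s hs) (memLp_const 1)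
    simp only [mul_one, condExp_const hI] at this
    exact this
  · have := Measure.isProbabilityMeasure_map (μ := ν) (measurable_snd (α := Y) (β := Y)).aemeasurable
    ext s hs
    rw [← measureReal_eq_measureReal_iff, map_measureReal_apply measurable_snd hs, ← hcond s hs,
      ← integral_indicator_one (measurable_snd hs)]
    have := hν (fun _ => 1) _ (memLp_const 1) (hind s hs)
    simp only [one_mul, condExp_const hI] at this
    exact this

lemma IsRelIndepSquare.ae_eq_mul {Y : Type*} {I : MeasurableSpace Y} [mY : MeasurableSpace Y]
    {m : Measure Y} [IsProbabilityMeasure m] (hI : I ≤ mY) {ν : Measure (Y × Y)}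
    (hν : IsRelIndepSquare I m ν) {F G : Y → ℝ} (h : F =ᵐ[m] G) :
    (fun z => F z.1 * F z.2) =ᵐ[ν] fun z => G z.1 * G z.2 := by
  obtain ⟨h1, h2⟩ := hν.map_fst_and_snd hI
  have e1 := h
  have e2 := h
  rw [← h1] at e1
  rw [← h2] at e2
  filter_upwards [ae_of_ae_map measurable_fst.aemeasurable e1,
    ae_of_ae_map measurable_snd.aemeasurable e2] with z hz1 hz2
  rw [hz1, hz2]

lemma IsHostKraMeasure.ae_eq_cubeProd [IsProbabilityMeasure μ] {T : X → X} {f g : X → ℝ}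
    (h : f =ᵐ[μ] g) : ∀ {k : ℕ} {ν : Measure (Cube X k)}, IsHostKraMeasure μ T k ν →
      cubeProd f k =ᵐ[ν] cubeProd g k
  | 0, _, hν => by
    obtain rfl : _ = μ := hν
    exact h
  | _ + 1, _, ⟨_, hm, hν⟩ => by
    have := hm.isProbabilityMeasure
    exact hν.ae_eq_mul (MeasurableSpace.invariants_le _) (hm.ae_eq_cubeProd h)

/-- The functional `f ↦ |||f|||_{k,T} ^ (2 ^ k)`. -/
noncomputable def hostKraFunctional (μ : Measure X) (T : X → X) (k : ℕ) (f : X → ℝ) : ℝ :=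
  ∫ y, cubeProd f k y ∂hostKraMeasure μ T k

lemma hostKraFunctional_succ [IsProbabilityMeasure μ] {T : X → X} {K : ℕ}
    {ν : Measure (Cube X K)} (hν : IsHostKraMeasure μ T K ν) {k : ℕ} (hk : k < K) {f : X → ℝ}
    (hf : UnitBounded f) : hostKraFunctional μ T (k + 1) f =
      ∫ y, ((hostKraMeasure μ T k)[cubeProd f k|MeasurableSpace.invariants (cubeMap T k)]) y *
        ((hostKraMeasure μ T k)[cubeProd f k|MeasurableSpace.invariants (cubeMap T k)]) y
          ∂hostKraMeasure μ T k := by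
  have := (isHostKraMeasure_hostKraMeasure hν hk.le).isProbabilityMeasure
  exact isRelIndepSquare_hostKraMeasure hν hk _ _ ((hf.cubeProd k).memLp ∞ _)
    ((hf.cubeProd k).memLp ∞ _)

/-- The left side is the squared integral of the conditional expectation `g`, the right side the
integral of its square; the gap is the variance of `g`. -/
lemma sq_hostKraFunctional_le [IsProbabilityMeasure μ] {T : X → X} {K : ℕ}
    {ν : Measure (Cube X K)} (hν : IsHostKraMeasure μ T K ν) {k : ℕ} (hk : k < K) {f : X → ℝ}
    (hf : UnitBounded f) : hostKraFunctional μ T k f ^ 2 ≤ hostKraFunctional μ T (k + 1) f := by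
  have := (isHostKraMeasure_hostKraMeasure hν hk.le).isProbabilityMeasure
  rw [hostKraFunctional_succ hν hk hf]
  set g := (hostKraMeasure μ T k)[cubeProd f k|MeasurableSpace.invariants (cubeMap T k)] with hg
  have hgm : MemLp g 2 (hostKraMeasure μ T k) := ((hf.cubeProd k).memLp 2 _).condExp one_le_two
  have hv := ProbabilityTheory.variance_nonneg g (hostKraMeasure μ T k)
  rw [ProbabilityTheory.variance_eq_sub hgm, sub_nonneg, hg,
    integral_condExp (MeasurableSpace.invariants_le _)] at hv
  refine hv.trans_eq ?_
  congr 1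
  ext y
  simp [sq, hg]

/-! ### The recursion formula along commuting transformations -/

/-- The average over `i, j < J` of the values of `Q` at `f (S ^ i x) f (S ^ j x)`. -/
noncomputable def differenceAverage {X : Type*} (Q : (X → ℝ) → ℝ) (S : X → X) (f : X → ℝ) (J : ℕ) : ℝ :=
  ((J : ℝ) ^ 2)⁻¹ * ∑ i ∈ Finset.range J, ∑ j ∈ Finset.range J,
    Q (fun x => f (S^[i] x) * f (S^[j] x))

lemma differenceAverage_hostKraFunctional {T : X → X} (S : X → X) (f : X → ℝ) (k J : ℕ) :
    differenceAverage (hostKraFunctional μ T k) S f J =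
      ((J : ℝ) ^ 2)⁻¹ * ∑ i ∈ Finset.range J, ∑ j ∈ Finset.range J,
        ∫ y, cubeProd f k ((cubeMap S k)^[i] y) * cubeProd f k ((cubeMap S k)^[j] y)
          ∂hostKraMeasure μ T k := by
  simp only [differenceAverage, hostKraFunctional, cubeMap_iterate, cubeProd_cubeMap,
    ← cubeProd_mul]

lemma sum_sum_sum_sum_comm {ι κ : Type*} (s : Finset ι) (t : Finset κ) (h : ι → ι → κ → κ → ℝ) :
    ∑ i ∈ s, ∑ j ∈ s, ∑ p ∈ t, ∑ q ∈ t, h i j p q =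
      ∑ p ∈ t, ∑ q ∈ t, ∑ i ∈ s, ∑ j ∈ s, h i j p q := by
  rw [← Finset.sum_product' s s fun i j => ∑ p ∈ t, ∑ q ∈ t, h i j p q,
    ← Finset.sum_product' t t fun p q => ∑ i ∈ s, ∑ j ∈ s, h i j p q]
  simp only [← Finset.sum_product' t t, ← Finset.sum_product' s s]
  exact Finset.sum_comm

/-- Both sides are the same fourfold average, since the iterates of `S` and `T` commute. -/
lemma differenceAverage_comm {X : Type*} (Q : (X → ℝ) → ℝ) {S T : X → X} (hTS : ∀ x, T (S x) = S (T x))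
    (f : X → ℝ) (J L : ℕ) :
    ((J : ℝ) ^ 2)⁻¹ * ∑ i ∈ Finset.range J, ∑ j ∈ Finset.range J,
        differenceAverage Q T (fun x => f (S^[i] x) * f (S^[j] x)) L =
      ((L : ℝ) ^ 2)⁻¹ * ∑ i ∈ Finset.range L, ∑ j ∈ Finset.range L,
        differenceAverage Q S (fun x => f (T^[i] x) * f (T^[j] x)) J := by
  have hST : ∀ i k x, T^[k] (S^[i] x) = S^[i] (T^[k] x) := fun i k x =>
    (Function.Commute.iterate_iterate (show Function.Commute T S from hTS) k i) x
  simp only [differenceAverage, ← Finset.mul_sum]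
  rw [mul_left_comm, sum_sum_sum_sum_comm]
  congr 2
  refine Finset.sum_congr rfl fun p _ => Finset.sum_congr rfl fun q _ =>
    Finset.sum_congr rfl fun i _ => Finset.sum_congr rfl fun j _ => congrArg Q (funext fun x => ?_)
  simp only [hST]
  ring

/-- Two iterated limits agree if in both the inner limit is at most the values. -/
lemma iterated_limits_eq {b : ℕ → ℕ → ℝ} {x y : ℕ → ℝ} {a c : ℝ}
    (hx : ∀ J, Tendsto (fun K => b J K) atTop (𝓝 (x J)))
    (hy : ∀ K, Tendsto (fun J => b J K) atTop (𝓝 (y K)))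
    (hxb : ∀ J K, K ≠ 0 → x J ≤ b J K) (hyb : ∀ J K, J ≠ 0 → y K ≤ b J K)
    (ha : Tendsto x atTop (𝓝 a)) (hc : Tendsto y atTop (𝓝 c)) : a = c := by
  -- Let `J → ∞` in `x J ≤ b J K` to get `a ≤ y K`, then let `K → ∞`; the other inequality is
  -- symmetric.
  refine le_antisymm (ge_of_tendsto hc ?_) (ge_of_tendsto ha ?_)
  · filter_upwards [eventually_ne_atTop 0] with K hK
    exact le_of_tendsto_of_tendsto' ha (hy K) fun J => hxb J K hK
  · filter_upwards [eventually_ne_atTop 0] with J hJ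
    exact le_of_tendsto_of_tendsto' hc (hx J) fun K => hyb J K hJ

/-- The recursion formula for the seminorms of `T` holds along each ergodic transformation that
commutes with `T`. -/
lemma differenceAverage_tendsto_and_le [IsProbabilityMeasure μ] {T : X → X} (hT : Ergodic T μ)
    {K : ℕ} {ν : Measure (Cube X K)} (hν : IsHostKraMeasure μ T K ν) {S : X → X}
    (hS : Ergodic S μ) (hTS : ∀ x, T (S x) = S (T x)) {k : ℕ} (hk : k < K) {f : X → ℝ}
    (hf : UnitBounded f) :
    Tendsto (differenceAverage (hostKraFunctional μ T k) S f) atTop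
        (𝓝 (hostKraFunctional μ T (k + 1) f)) ∧
      ∀ J, J ≠ 0 → hostKraFunctional μ T (k + 1) f ≤
        differenceAverage (hostKraFunctional μ T k) S f J := by
  -- For each `R` commuting with `T` the mean ergodic theorem on the cube gives the limit, but as a
  -- conditional expectation on the sets invariant under the diagonal map of `R`. What remains is
  -- that `R = S` and `R = T` give the same value.
  have main : ∀ R : X → X, MeasurePreserving R μ μ → (∀ x, T (R x) = R (T x)) → ∀ k < K,
      ∀ f : X → ℝ, UnitBounded f → Tendsto (differenceAverage (hostKraFunctional μ T k) R f) atTop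
        (𝓝 (∫ y, ((hostKraMeasure μ T k)[cubeProd f k|MeasurableSpace.invariants (cubeMap R k)]) y *
          ((hostKraMeasure μ T k)[cubeProd f k|MeasurableSpace.invariants (cubeMap R k)]) y
            ∂hostKraMeasure μ T k)) ∧ ∀ J, J ≠ 0 →
        ∫ y, ((hostKraMeasure μ T k)[cubeProd f k|MeasurableSpace.invariants (cubeMap R k)]) y *
          ((hostKraMeasure μ T k)[cubeProd f k|MeasurableSpace.invariants (cubeMap R k)]) y
            ∂hostKraMeasure μ T k ≤ differenceAverage (hostKraFunctional μ T k) R f J := by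
    intro R hR hTR k hk f hf
    have hν' := isHostKraMeasure_hostKraMeasure hν hk.le
    have := hν'.isProbabilityMeasure
    have hR' := (hν'.measurePreserving_cubeMap hT.toMeasurePreserving hR hTR).2
    have hF := (hf.cubeProd k).memLp 2 (hostKraMeasure μ T k)
    have heq := differenceAverage_hostKraFunctional (μ := μ) (T := T) R f k
    constructor
    · exact (tendsto_average_correlation hR' hF hF).congr fun J => (heq J).symm
    · intro J hJ
      rw [heq]
      exact integral_condExp_mul_le_average hR' hF hJ
  have hTT : ∀ k < K, ∀ f : X → ℝ, UnitBounded f →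
      Tendsto (differenceAverage (hostKraFunctional μ T k) T f) atTop
        (𝓝 (hostKraFunctional μ T (k + 1) f)) ∧
      ∀ J, J ≠ 0 → hostKraFunctional μ T (k + 1) f ≤
        differenceAverage (hostKraFunctional μ T k) T f J := by
    intro k hk f hf
    rw [hostKraFunctional_succ hν hk hf]
    exact main T hT.toMeasurePreserving (fun _ => rfl) k hk f hf
  suffices hlim : ∀ f : X → ℝ, UnitBounded f →
      Tendsto (differenceAverage (hostKraFunctional μ T k) S f) atTop
        (𝓝 (hostKraFunctional μ T (k + 1) f)) by
    obtain ⟨h1, h2⟩ := main S hS.toMeasurePreserving hTS k hk f hf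
    refine ⟨hlim f hf, ?_⟩
    rwa [tendsto_nhds_unique (hlim f hf) h1]
  induction k with
  | zero =>
    intro f hf
    have h0 : hostKraMeasure μ T 0 = μ := isHostKraMeasure_hostKraMeasure hν (Nat.zero_le K)
    have h1 := (main S hS.toMeasurePreserving hTS 0 hk f hf).1
    rw [hostKraFunctional_succ hν hk hf]
    rw [h0] at h1 ⊢
    refine (congrArg (fun c => Tendsto _ _ (𝓝 c)) ?_).mp h1
    refine integral_congr_ae ?_
    -- At level zero, ergodicity of `S` and of `T` makes both conditional expectations equal to the
    -- constant `∫ f`.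
    have e1 := condExp_invariants_of_ergodic hS (F := f)
    have e2 := condExp_invariants_of_ergodic hT (F := f)
    filter_upwards [e1, e2] with y hy1 hy2
    change (μ[f|MeasurableSpace.invariants S]) y * (μ[f|MeasurableSpace.invariants S]) y =
      (μ[f|MeasurableSpace.invariants T]) y * (μ[f|MeasurableSpace.invariants T]) y
    rw [hy1, hy2]
  | succ k ih =>
    intro f hf
    have hk' : k < K := by omega
    have ih' : ∀ g : X → ℝ, UnitBounded g →
        Tendsto (differenceAverage (hostKraFunctional μ T k) S g) atTop
          (𝓝 (hostKraFunctional μ T (k + 1) g)) ∧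
        ∀ J, J ≠ 0 → hostKraFunctional μ T (k + 1) g ≤
          differenceAverage (hostKraFunctional μ T k) S g J := by
      intro g hg
      obtain ⟨h1, h2⟩ := main S hS.toMeasurePreserving hTS k hk' g hg
      have h3 := ih hk' g hg
      refine ⟨h3, ?_⟩
      rwa [tendsto_nhds_unique h3 h1]
    have hD : ∀ {R : X → X}, Measurable R → ∀ i j,
        UnitBounded (fun x => f (R^[i] x) * f (R^[j] x)) := fun hR i j =>
      (hf.comp (hR.iterate i)).mul (hf.comp (hR.iterate j))
    obtain ⟨h1, -⟩ := main S hS.toMeasurePreserving hTS (k + 1) hk f hf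
    refine (congrArg (fun c => Tendsto _ _ (𝓝 c)) ?_).mp h1
    -- The array averages level `k` over differences in both directions. By the recursion at level
    -- `k`, the limit in `L` leaves the `S`-average of level `k + 1`, and the limit in `J` leaves
    -- its `T`-average, whose limit is known.
    refine iterated_limits_eq
      (b := fun J L => ((J : ℝ) ^ 2)⁻¹ * ∑ i ∈ Finset.range J, ∑ j ∈ Finset.range J,
        differenceAverage (hostKraFunctional μ T k) T (fun x => f (S^[i] x) * f (S^[j] x)) L)
      (y := differenceAverage (hostKraFunctional μ T (k + 1)) T f)
      (fun J => ?_) (fun L => ?_) (fun J L hL => ?_) (fun J L hJ => ?_) h1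
      (hTT (k + 1) hk f hf).1
    · exact Tendsto.const_mul _ (tendsto_finsetSum _ fun i _ => tendsto_finsetSum _ fun j _ =>
        (hTT k hk' _ (hD hS.measurable i j)).1)
    · simp only [differenceAverage_comm _ hTS]
      exact Tendsto.const_mul _ (tendsto_finsetSum _ fun i _ => tendsto_finsetSum _ fun j _ =>
        (ih' _ (hD hT.measurable i j)).1)
    · exact mul_le_mul_of_nonneg_left (Finset.sum_le_sum fun i _ => Finset.sum_le_sum fun j _ =>
        (hTT k hk' _ (hD hS.measurable i j)).2 L hL) (by positivity)
    · rw [differenceAverage_comm _ hTS]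
      exact mul_le_mul_of_nonneg_left (Finset.sum_le_sum fun i _ => Finset.sum_le_sum fun j _ =>
        (ih' _ (hD hT.measurable i j)).2 J hJ) (by positivity)

end HostKra

/-! ### The action generated by a system -/

section Systems

variable {X : Type*} {l : ℕ}

lemma monomialMap_zero (T : Fin l → Equiv.Perm X) : monomialMap T 0 = 1 := by
  simp [monomialMap]

lemma monomialMap_succ (T : Fin (l + 1) → Equiv.Perm X) (c : Fin (l + 1) → ℤ) :
    monomialMap T c = T 0 ^ c 0 * monomialMap (fun j => T j.succ) (fun j => c j.succ) := by
  simp [monomialMap, List.ofFn_succ]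

lemma commute_monomialMap {T : Fin l → Equiv.Perm X} {S : Equiv.Perm X}
    (h : ∀ j, Commute S (T j)) (c : Fin l → ℤ) : Commute S (monomialMap T c) := by
  refine Commute.list_prod_right _ _ fun x hx => ?_
  obtain ⟨j, rfl⟩ := (List.mem_ofFn' _ _).1 hx
  exact (h j).zpow_right _

lemma monomialMap_add {T : Fin l → Equiv.Perm X} (hT : ∀ i j, Commute (T i) (T j))
    (a b : Fin l → ℤ) : monomialMap T (a + b) = monomialMap T a * monomialMap T b := by
  induction l with
  | zero => simp [monomialMap]
  | succ l ih =>
    have h := ih (T := fun j => T j.succ) (fun i j => hT _ _) (fun j => a j.succ)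
      (fun j => b j.succ)
    have hc : Commute (T 0 ^ b 0) (monomialMap (fun j => T j.succ) fun j => a j.succ) :=
      commute_monomialMap (fun j => (hT _ _).zpow_left _) _
    rw [monomialMap_succ, monomialMap_succ T a, monomialMap_succ T b, Pi.add_apply, zpow_add]
    change _ * monomialMap (fun j => T j.succ) ((fun j => a j.succ) + fun j => b j.succ) = _
    rw [h, mul_assoc, mul_assoc, ← mul_assoc (T 0 ^ b 0), hc.eq, mul_assoc]

lemma monomialMap_single (T : Fin l → Equiv.Perm X) (j : Fin l) :
    monomialMap T (Pi.single j 1) = T j := by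
  induction l with
  | zero => exact j.elim0
  | succ l ih =>
    rw [monomialMap_succ]
    cases j using Fin.cases with
    | zero =>
      have : (fun j : Fin l => (Pi.single 0 1 : Fin (l + 1) → ℤ) j.succ) = 0 := by
        ext j
        simp
      rw [this, monomialMap_zero]
      simp
    | succ j =>
      have : (fun i : Fin l => (Pi.single j.succ 1 : Fin (l + 1) → ℤ) i.succ) = Pi.single j 1 := by
        ext i
        by_cases h : i = j
        · simp [h]
        · simp [Pi.single_eq_of_ne h, Pi.single_eq_of_ne (fun h' => h (Fin.succ_injective _ h'))]
      rw [this, ih]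
      simp

variable [MeasurableSpace X] {μ : Measure X}

lemma measurePreserving_symm {S : Equiv.Perm X} (hS : MeasurePreserving S μ μ)
    (hS' : Measurable S.symm) : MeasurePreserving S.symm μ μ :=
  MeasurePreserving.symm (⟨S, hS.measurable, hS'⟩ : X ≃ᵐ X) hS

lemma measurePreserving_pow {S : Equiv.Perm X} (hS : MeasurePreserving S μ μ) (n : ℕ) :
    MeasurePreserving (S ^ n : Equiv.Perm X) μ μ := by
  rw [Equiv.Perm.coe_pow]
  exact hS.iterate n

lemma measurePreserving_zpow {S : Equiv.Perm X} (hS : MeasurePreserving S μ μ)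
    (hS' : Measurable S.symm) (n : ℤ) : MeasurePreserving (S ^ n : Equiv.Perm X) μ μ := by
  cases n with
  | ofNat n => exact measurePreserving_pow hS n
  | negSucc n =>
    rw [zpow_negSucc, ← inv_pow]
    exact measurePreserving_pow (S := S⁻¹) (measurePreserving_symm hS hS') _

lemma IsSystem.measurePreserving_monomialMap {T : Fin l → Equiv.Perm X} (hT : IsSystem μ T)
    (c : Fin l → ℤ) : MeasurePreserving (monomialMap T c) μ μ := by
  unfold monomialMap
  have h : ∀ S ∈ List.ofFn fun j => T j ^ c j, MeasurePreserving S μ μ := by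
    intro S hS
    obtain ⟨j, rfl⟩ := (List.mem_ofFn' _ _).1 hS
    exact measurePreserving_zpow (hT.measurePreserving j) (hT.measurable_symm j) _
  generalize (List.ofFn fun j => T j ^ c j) = L at h ⊢
  induction L with
  | nil => exact MeasurePreserving.id μ
  | cons S L ih =>
    rw [List.prod_cons, Equiv.Perm.coe_mul]
    exact (h S (by simp)).comp (ih fun R hR => h R (by simp [hR]))

lemma IsSystem.isAction {T : Fin l → Equiv.Perm X} (hT : IsSystem μ T) :
    IsAction μ (fun c : Fin l → ℤ => monomialMap T c) where
  zero x := by rw [monomialMap_zero]; rfl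
  add a b x := by rw [monomialMap_add hT.commute]; rfl
  measurePreserving := hT.measurePreserving_monomialMap

lemma IsAction.iterate {B : Type*} [AddCommGroup B] {τ : B → X → X} (hτ : IsAction μ τ) (w : B)
    (i : ℕ) (x : X) : (τ w)^[i] x = τ (i • w) x := by
  induction i with
  | zero => simp [hτ.zero]
  | succ i ih => rw [Function.iterate_succ_apply', ih, succ_nsmul', hτ.add]

/-- Total ergodicity is used here: every nonzero `w` acts by an ergodic map commuting with `T j`, so
the recursion formula is available along it. -/
lemma IsFreelyGeneratedTotallyErgodic.isUniformity [IsProbabilityMeasure μ]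
    {T : Fin l → Equiv.Perm X} (hT : IsFreelyGeneratedTotallyErgodic μ T) {j : Fin l} {K : ℕ}
    {ν : Measure (Cube X K)} (hν : IsHostKraMeasure μ (T j) K ν) :
    IsUniformity μ (fun c : Fin l → ℤ => monomialMap T c) K (hostKraFunctional μ (T j)) := by
  have hcomm : ∀ c x, T j (monomialMap T c x) = monomialMap T c (T j x) := fun c x =>
    Equiv.ext_iff.1 (commute_monomialMap (hT.commute j) c).eq x
  have herg : Ergodic (T j) μ := by
    rw [← monomialMap_single T j]
    refine hT.ergodic _ fun h => ?_
    have := congrFun h j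
    simp at this
  refine ⟨fun f _ => ?_, fun n hn f hf c => ?_, fun n hn f hf => sq_hostKraFunctional_le hν hn hf,
    fun n hn f hf w hw => ?_⟩
  · have h0 : hostKraMeasure μ (T j) 0 = μ := isHostKraMeasure_hostKraMeasure hν (Nat.zero_le K)
    rw [hostKraFunctional, h0]
    rfl
  · have hmp := ((isHostKraMeasure_hostKraMeasure hν hn).measurePreserving_cubeMap
      (hT.measurePreserving j) (hT.measurePreserving_monomialMap c) (hcomm c)).2
    unfold hostKraFunctional
    simp only [← cubeProd_cubeMap]
    rw [← integral_map hmp.measurable.aemeasurable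
      (hf.cubeProd n).measurable.aestronglyMeasurable, hmp.map_eq]
  · have h := (differenceAverage_tendsto_and_le herg hν (hT.ergodic w hw) (hcomm w) hn hf).1
    unfold differenceAverage at h
    simpa only [hT.toIsSystem.isAction.iterate w] using h

end Systems

/-! ### Integer valued polynomials -/

section IntPolynomials

variable {A A' B C : Type*} [AddCommGroup A] [AddCommGroup A'] [AddCommGroup B] [AddCommGroup C]

lemma comp_mem_polyLT_iff {φ : B →+ C} (hφ : Function.Injective φ) {n : ℕ} {p : A → B} :
    (fun u => φ (p u)) ∈ polyLT A C n ↔ p ∈ polyLT A B n := by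
  induction n generalizing p with
  | zero =>
    simp only [mem_polyLT_zero, funext_iff, Pi.zero_apply, map_eq_zero_iff φ hφ]
  | succ n ih =>
    simp only [mem_polyLT_succ, ← map_sub]
    exact forall_congr' fun h => ih (p := fun u => p (u + h) - p u)

lemma comp_addMonoidHom_mem_polyLT (π : A' →+ A) {n : ℕ} {p : A → B} (hp : p ∈ polyLT A B n) :
    (fun u => p (π u)) ∈ polyLT A' B n := by
  induction n generalizing p with
  | zero =>
    rw [mem_polyLT_zero] at hp ⊢
    rw [hp]
    rfl
  | succ n ih =>
    rw [mem_polyLT_succ] at hp ⊢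
    intro h
    simp only [map_add]
    exact ih (hp (π h))

lemma mem_polyLT_pi {κ : Type*} {n : ℕ} {p : A → κ → B}
    (hp : ∀ j, (fun u => p u j) ∈ polyLT A B n) : p ∈ polyLT A (κ → B) n := by
  induction n generalizing p with
  | zero =>
    rw [mem_polyLT_zero]
    ext u j
    exact congrFun (mem_polyLT_zero.1 (hp j)) u
  | succ n ih =>
    rw [mem_polyLT_succ]
    exact fun h => ih fun j => mem_polyLT_succ.1 (hp j) h

/-- Leibniz rule: the difference of `p φ` in the step `h` is the difference of `p` times `φ`, plus
`p (u + h) * φ h`. -/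
lemma additive_mul_mem_polyLT (φ : A →+ ℚ) {n : ℕ} {p : A → ℚ} (hp : p ∈ polyLT A ℚ n) :
    (fun u => p u * φ u) ∈ polyLT A ℚ (n + 1) := by
  induction n generalizing p with
  | zero =>
    rw [mem_polyLT_zero.1 hp]
    convert zero_mem (polyLT A ℚ 1) using 1
    ext
    simp
  | succ n ih =>
    rw [mem_polyLT_succ]
    intro h
    have h1 := ih (mem_polyLT_succ.1 hp h)
    have h2 : (fun u => p (u + h) * φ h) ∈ polyLT A ℚ (n + 1) := by
      rcases eq_or_ne (φ h) 0 with h0 | h0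
      · convert zero_mem (polyLT A ℚ (n + 1)) using 1
        ext
        simp [h0]
      · exact (comp_mem_polyLT_iff (φ := AddMonoidHom.mulRight (φ h))
          (mul_left_injective₀ h0)).2 (translate_mem_polyLT hp h)
    convert add_mem h1 h2 using 1
    ext u
    simp only [map_add, Pi.add_apply]
    ring

lemma exists_eval_mem_polyLT {d : ℕ} (q : MvPolynomial (Fin d) ℚ) :
    ∃ n, (fun u : Fin d → ℤ => MvPolynomial.eval (fun a => (u a : ℚ)) q) ∈
      polyLT (Fin d → ℤ) ℚ n := by
  induction q using MvPolynomial.induction_on with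
  | C c =>
    refine ⟨1, mem_polyLT_one.2 fun u => ?_⟩
    simp
  | add q q' h h' =>
    obtain ⟨n, hn⟩ := h
    obtain ⟨n', hn'⟩ := h'
    refine ⟨max n n', ?_⟩
    simp only [map_add]
    exact add_mem (polyLT_mono (le_max_left _ _) hn) (polyLT_mono (le_max_right _ _) hn')
  | mul_X q i h =>
    obtain ⟨n, hn⟩ := h
    refine ⟨n + 1, ?_⟩
    simp only [map_mul, MvPolynomial.eval_X]
    exact additive_mul_mem_polyLT
      ((Int.castAddHom ℚ).comp (Pi.evalAddMonoidHom (fun _ : Fin d => ℤ) i)) hn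

lemma IsIntPolynomial.exists_mem_polyLT {d : ℕ} {p : (Fin d → ℤ) → ℤ} (hp : IsIntPolynomial p) :
    ∃ n, p ∈ polyLT (Fin d → ℤ) ℤ n := by
  obtain ⟨q, hq⟩ := hp
  obtain ⟨n, hn⟩ := exists_eval_mem_polyLT q
  refine ⟨n, (comp_mem_polyLT_iff (φ := Int.castAddHom ℚ) Int.cast_injective).1 ?_⟩
  simpa only [Int.coe_castAddHom, hq] using hn

lemma exists_mem_polyLT_pi {d l : ℕ} {p : Fin l → (Fin d → ℤ) → ℤ}
    (hp : ∀ j, IsIntPolynomial (p j)) :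
    ∃ n, (fun u j => p j u) ∈ polyLT (Fin d → ℤ) (Fin l → ℤ) n := by
  choose n hn using fun j => (hp j).exists_mem_polyLT
  exact ⟨Finset.univ.sup n, mem_polyLT_pi fun j =>
    polyLT_mono (Finset.le_sup (Finset.mem_univ j)) (hn j)⟩

/-! ### Doubling the variables -/

/-- The rows of the family `p`, as functions of each of two variables. -/
def doubledFamily {d r l : ℕ} (p : Fin r → Fin l → (Fin d → ℤ) → ℤ) :
    Fin r ⊕ Fin r → (Fin d → ℤ) × (Fin d → ℤ) → Fin l → ℤ
  | Sum.inl i => fun u j => p i j u.1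
  | Sum.inr i => fun u j => p i j u.2

lemma exists_doubledFamily_mem_polyLT {d r l : ℕ} {p : Fin r → Fin l → (Fin d → ℤ) → ℤ}
    (hp : ∀ i j, IsIntPolynomial (p i j)) (x : Fin r ⊕ Fin r) :
    ∃ n, doubledFamily p x ∈ polyLT ((Fin d → ℤ) × (Fin d → ℤ)) (Fin l → ℤ) n := by
  rcases x with i | i <;> obtain ⟨n, hn⟩ := exists_mem_polyLT_pi (hp i)
  · exact ⟨n, comp_addMonoidHom_mem_polyLT (AddMonoidHom.fst (Fin d → ℤ) (Fin d → ℤ)) hn⟩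
  · exact ⟨n, comp_addMonoidHom_mem_polyLT (AddMonoidHom.snd (Fin d → ℤ) (Fin d → ℤ)) hn⟩

/-- Restrict to `(u, 0)`. Against a row in the first variable, a constant difference would vanish in
each column, so two rows would coincide. Against a row in the second variable, it would make row `m`
constant, hence zero. -/
lemma IsEDSet.doubledFamily_sub_notMem {d r l : ℕ} {p : Fin r → Fin l → (Fin d → ℤ) → ℤ}
    (hp : IsEDSet p) (m : Fin r) (x : Fin r ⊕ Fin r) (hx : x ≠ Sum.inl m) :
    doubledFamily p (Sum.inl m) - doubledFamily p x ∉
      polyLT ((Fin d → ℤ) × (Fin d → ℤ)) (Fin l → ℤ) 1 := by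
  rw [mem_polyLT_one]
  intro h
  rcases x with i | i
  · obtain ⟨j, hj⟩ := hp.rows_ne m i fun him => hx (by rw [him])
    have h1 : ∀ u, p m j u - p i j u = p m j 0 - p i j 0 := fun u => congrFun (h (u, 0)) j
    have h2 := hp.sub_ne_const _ _ _ _ _ h1
    exact hj (funext fun u => sub_eq_zero.1 ((h1 u).trans h2))
  · obtain ⟨j, hj⟩ := hp.row_ne_zero m
    have h1 : ∀ u, p m j u - p i j 0 = p m j 0 - p i j 0 := fun u => congrFun (h (u, 0)) j
    have h2 : ∀ u, p m j u = p m j 0 := fun u => by linarith [h1 u]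
    have h3 := hp.ne_const _ _ _ h2
    exact hj (funext fun u => (h2 u).trans h3)

end IntPolynomials

/-! ### Means along Følner sequences -/

section Folner

/-- The two sums run over `h + s` and `s`, so only the symmetric difference contributes. -/
lemma abs_sum_translate_sub_le {A : Type*} [AddCommGroup A] [DecidableEq A] (s : Finset A)
    {φ : A → ℝ} {C : ℝ} (hφ : ∀ a, |φ a| ≤ C) (h : A) :
    |∑ a ∈ s, φ (a + h) - ∑ a ∈ s, φ a| ≤ C * (symmDiff (s.image fun a => h + a) s).card := by
  have h1 : ∑ a ∈ s, φ (a + h) = ∑ a ∈ s.image (fun a => h + a), φ a := by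
    rw [Finset.sum_image fun a _ b _ hab => add_left_cancel hab]
    exact Finset.sum_congr rfl fun a _ => by rw [add_comm]
  rw [h1, ← Finset.sum_sdiff_sub_sum_sdiff]
  set t := s.image fun a => h + a
  have hb : ∀ u : Finset A, |∑ a ∈ u, φ a| ≤ C * u.card := fun u =>
    (Finset.abs_sum_le_sum_abs _ _).trans ((Finset.sum_le_sum fun a _ => hφ a).trans (by
      simp [mul_comm]))
  have hcard : (symmDiff t s).card = (t \ s).card + (s \ t).card := by
    rw [symmDiff_def, Finset.sup_eq_union, Finset.card_union_of_disjoint]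
    exact disjoint_sdiff_sdiff
  rw [hcard, Nat.cast_add, mul_add]
  exact (abs_sub _ _).trans (add_le_add (hb _) (hb _))

lemma card_symmDiff_product_le {A B : Type*} [DecidableEq A] [DecidableEq B] (s s' : Finset A)
    (t t' : Finset B) : (symmDiff (s' ×ˢ t') (s ×ˢ t)).card ≤
      (symmDiff s' s).card * t'.card + s.card * (symmDiff t' t).card := by
  rw [← Finset.card_product, ← Finset.card_product]
  refine (Finset.card_le_card fun x hx => ?_).trans (Finset.card_union_le _ _)
  simp only [Finset.mem_union, Finset.mem_product, Finset.mem_symmDiff] at hx ⊢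
  tauto

variable {d : ℕ} {Φ : ℕ → Finset (Fin d → ℤ)}

/-- The average of `φ` over `Φ N ×ˢ Φ N`. -/
noncomputable def squareAverage (Φ : ℕ → Finset (Fin d → ℤ)) (φ : (Fin d → ℤ) × (Fin d → ℤ) → ℝ)
    (N : ℕ) : ℝ :=
  (((Φ N).card : ℝ) ^ 2)⁻¹ * ∑ a ∈ Φ N ×ˢ Φ N, φ a

lemma abs_squareAverage_le {φ : (Fin d → ℤ) × (Fin d → ℤ) → ℝ} {C : ℝ} (hφ : ∀ a, |φ a| ≤ C)
    (N : ℕ) : |squareAverage Φ φ N| ≤ C := by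
  have hC : 0 ≤ C := (abs_nonneg _).trans (hφ 0)
  unfold squareAverage
  rcases (Φ N).eq_empty_or_nonempty with h | h
  · simp [h, hC]
  have hc : (0 : ℝ) < (Φ N).card := by exact_mod_cast h.card_pos
  rw [abs_mul, abs_inv, abs_of_nonneg (sq_nonneg _), inv_mul_le_iff₀ (by positivity)]
  refine (Finset.abs_sum_le_sum_abs _ _).trans ((Finset.sum_le_sum fun a _ => hφ a).trans ?_)
  simp [sq]

/-- The squares of the sets of a Følner sequence form a Følner sequence in the product group. -/
lemma IsFolner.tendsto_squareAverage_translate (hΦ : IsFolner Φ)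
    {φ : (Fin d → ℤ) × (Fin d → ℤ) → ℝ} {C : ℝ} (hφ : ∀ a, |φ a| ≤ C)
    (h : (Fin d → ℤ) × (Fin d → ℤ)) :
    Tendsto (fun N => squareAverage Φ (fun a => φ (a + h)) N - squareAverage Φ φ N) atTop
      (𝓝 0) := by
  have hlim := ((hΦ.tendsto h.1).add (hΦ.tendsto h.2)).const_mul C
  rw [add_zero, mul_zero] at hlim
  refine squeeze_zero_norm (fun N => ?_) hlim
  have hc : (0 : ℝ) < (Φ N).card := by exact_mod_cast (hΦ.nonempty N).card_pos
  have hC : 0 ≤ C := (abs_nonneg _).trans (hφ 0)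
  have h1 := abs_sum_translate_sub_le (Φ N ×ˢ Φ N) hφ h
  have h2 : (Φ N ×ˢ Φ N).image (fun a => h + a) =
      ((Φ N).image fun u => h.1 + u) ×ˢ ((Φ N).image fun u => h.2 + u) :=
    (Finset.prodMap_image_product (fun u => h.1 + u) (fun u => h.2 + u) (Φ N) (Φ N)).symm ▸ rfl
  rw [h2] at h1
  have h3 := card_symmDiff_product_le (Φ N) ((Φ N).image fun u => h.1 + u) (Φ N)
    ((Φ N).image fun u => h.2 + u)
  rw [Finset.card_image_of_injective _ (add_right_injective h.2)] at h3
  have h4 : ((symmDiff (((Φ N).image fun u => h.1 + u) ×ˢ ((Φ N).image fun u => h.2 + u))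
      (Φ N ×ˢ Φ N)).card : ℝ) ≤ (symmDiff ((Φ N).image fun u => h.1 + u) (Φ N)).card * (Φ N).card +
        (Φ N).card * (symmDiff ((Φ N).image fun u => h.2 + u) (Φ N)).card := by exact_mod_cast h3
  unfold squareAverage
  rw [← mul_sub, Real.norm_eq_abs, abs_mul, abs_inv, abs_of_nonneg (sq_nonneg _),
    inv_mul_le_iff₀ (by positivity)]
  refine h1.trans ((mul_le_mul_of_nonneg_left h4 hC).trans_eq ?_)
  field_simp

lemma exists_tendsto_squareAverage (U : Ultrafilter ℕ) {φ : (Fin d → ℤ) × (Fin d → ℤ) → ℝ}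
    (hφ : ∃ C, ∀ a, |φ a| ≤ C) : ∃ x, Tendsto (squareAverage Φ φ) U (𝓝 x) := by
  obtain ⟨C, hC⟩ := hφ
  -- The averages stay in the compact interval `[-C, C]`, where every ultrafilter converges.
  obtain ⟨x, -, hx⟩ := (isCompact_Icc (a := -C) (b := C)).ultrafilter_le_nhds
    (U.map (squareAverage Φ φ)) (by
      rw [le_principal_iff]
      exact mem_map.2 (univ_mem' fun N => abs_le.1 (abs_squareAverage_le hC N)))
  exact ⟨x, hx⟩

lemma tendsto_squareAverage_limUnder (U : Ultrafilter ℕ) {φ : (Fin d → ℤ) × (Fin d → ℤ) → ℝ}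
    (hφ : ∃ C, ∀ a, |φ a| ≤ C) :
    Tendsto (squareAverage Φ φ) U (𝓝 (limUnder (U : Filter ℕ) (squareAverage Φ φ))) :=
  tendsto_nhds_limUnder (exists_tendsto_squareAverage U hφ)

/-- The invariant mean given by the limits, along an ultrafilter, of the averages over
`Φ N ×ˢ Φ N`. -/
noncomputable def IsFolner.invariantMean (hΦ : IsFolner Φ) (U : Ultrafilter ℕ)
    (hU : (U : Filter ℕ) ≤ atTop) : InvariantMean ((Fin d → ℤ) × (Fin d → ℤ)) where
  mean φ := limUnder (U : Filter ℕ) (squareAverage Φ φ)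
  mean_add φ ψ hφ hψ := by
    refine Tendsto.limUnder_eq (((tendsto_squareAverage_limUnder U hφ).add
      (tendsto_squareAverage_limUnder U hψ)).congr fun N => ?_)
    simp only [squareAverage, Finset.sum_add_distrib, mul_add]
  mean_const_mul c φ hφ := by
    refine Tendsto.limUnder_eq (((tendsto_squareAverage_limUnder U hφ).const_mul c).congr
      fun N => ?_)
    simp only [squareAverage, ← Finset.mul_sum]
    ring
  mean_nonneg φ hφ h := ge_of_tendsto' (tendsto_squareAverage_limUnder U hφ) fun N =>
    mul_nonneg (by positivity) (Finset.sum_nonneg fun a _ => h a)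
  mean_one := by
    refine Tendsto.limUnder_eq (tendsto_const_nhds.congr fun N => ?_)
    have hc : ((Φ N).card : ℝ) ≠ 0 := by exact_mod_cast (hΦ.nonempty N).card_pos.ne'
    simp only [squareAverage, Finset.sum_const, Finset.card_product, nsmul_eq_mul, Nat.cast_mul]
    field_simp
  mean_translate φ h hφ := by
    obtain ⟨C, hC⟩ := hφ
    refine Tendsto.limUnder_eq ?_
    have h1 := ((hΦ.tendsto_squareAverage_translate hC h).mono_left hU).add
      (tendsto_squareAverage_limUnder (Φ := Φ) U ⟨C, hC⟩)
    rw [zero_add] at h1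
    exact h1.congr fun N => sub_add_cancel _ _

end Folner

/-! ### Convergence of polynomial averages -/

section Convergence

variable {X : Type u} [MeasurableSpace X] {μ : Measure X} {d r l : ℕ}

/-- An essentially bounded function is, up to a null set, a multiple of a function bounded by
one. -/
lemma exists_unitBounded {f : X → ℝ} (hf : MemLp f ∞ μ) :
    ∃ (C : ℝ) (g : X → ℝ), 0 < C ∧ UnitBounded g ∧ f =ᵐ[μ] fun x => C * g x := by
  set C : ℝ := (eLpNorm f ∞ μ).toReal + 1 with hC
  have hC0 : 0 < C := by positivity
  have hbound : ∀ᵐ x ∂μ, |f x| ≤ C := by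
    filter_upwards [ae_le_eLpNormEssSup (f := f) (μ := μ)] with x hx
    have h1 := ENNReal.toReal_mono hf.eLpNorm_ne_top
      (hx.trans_eq (eLpNorm_exponent_top (f := f) (μ := μ)).symm)
    rw [toReal_enorm, Real.norm_eq_abs] at h1
    linarith
  obtain ⟨f', hf', hff'⟩ := hf.1
  refine ⟨C, fun x => max (-1) (min 1 (f' x / C)), hC0,
    ⟨measurable_const.max (measurable_const.min (hf'.measurable.div_const C)), fun x => ?_⟩, ?_⟩
  · rw [abs_le]
    exact ⟨le_max_left _ _, max_le (by norm_num) (min_le_left _ _)⟩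
  · filter_upwards [hbound, hff'] with x hx hx'
    rw [hx', abs_le] at hx
    rw [hx', min_eq_right ((div_le_one hC0).2 hx.2), max_eq_right ((le_div_iff₀ hC0).2 (by linarith))]
    field_simp

/-- The square of a sum over `Φ N` is a double sum, and each product of two terms is one correlation
of the doubled family. Norm convergence thus becomes a statement about scalar means. -/
lemma integral_sq_polyAverage [IsProbabilityMeasure μ] {T : Fin l → Equiv.Perm X} (hT : IsSystem μ T)
    (p : Fin r → Fin l → (Fin d → ℤ) → ℤ) {g : Fin r → X → ℝ} (hg : ∀ i, UnitBounded (g i))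
    (Φ : ℕ → Finset (Fin d → ℤ)) (N : ℕ) :
    ∫ x, polyAverage T p g (Φ N) x ^ 2 ∂μ =
      squareAverage Φ (correlation μ (fun c : Fin l → ℤ => monomialMap T c) (doubledFamily p)
        (Sum.elim g g)) N := by
  have hcorr : ∀ a, correlation μ (fun c : Fin l → ℤ => monomialMap T c) (doubledFamily p)
      (Sum.elim g g) a = ∫ x, (∏ i, g i (monomialMap T (fun j => p i j a.1) x)) *
        ∏ i, g i (monomialMap T (fun j => p i j a.2) x) ∂μ := by
    intro a
    unfold correlation
    congr 1
    ext x
    rw [Fintype.prod_sum_type]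
    rfl
  have hG : ∀ u : Fin d → ℤ, UnitBounded
      (fun x => ∏ i, g i (monomialMap T (fun j => p i j u) x)) := fun u =>
    unitBounded_prod_action hT.isAction hg fun i j => p i j u
  simp only [squareAverage, hcorr]
  rw [← integral_finsetSum _ fun a _ => ((hG a.1).mul (hG a.2)).integrable μ, ← integral_const_mul]
  congr 1
  ext x
  rw [polyAverage, mul_pow, inv_pow, sq (∑ u ∈ Φ N, _), Finset.sum_mul_sum, Finset.sum_product]

lemma tendsto_eLpNorm_of_tendsto_integral_sq {F : ℕ → X → ℝ} (hF : ∀ N, MemLp (F N) 2 μ)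
    (h : Tendsto (fun N => ∫ x, F N x ^ 2 ∂μ) atTop (𝓝 0)) :
    Tendsto (fun N => eLpNorm (F N) 2 μ) atTop (𝓝 0) := by
  have h1 : ∀ N, eLpNorm (F N) 2 μ = ENNReal.ofReal ((∫ x, F N x ^ 2 ∂μ) ^ (2⁻¹ : ℝ)) := fun N => by
    rw [(hF N).eLpNorm_eq_integral_rpow_norm two_ne_zero ENNReal.ofNat_ne_top]
    simp
  simp only [h1]
  have h2 := ENNReal.tendsto_ofReal (h.rpow_const (p := (2⁻¹ : ℝ)) (Or.inr (by norm_num)))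
  rwa [Real.zero_rpow (by norm_num), ENNReal.ofReal_zero] at h2

lemma polyAverage_ae_eq {T : Fin l → Equiv.Perm X} (hT : IsSystem μ T)
    (p : Fin r → Fin l → (Fin d → ℤ) → ℤ) {f g : Fin r → X → ℝ} {C : Fin r → ℝ}
    (h : ∀ i, f i =ᵐ[μ] fun x => C i * g i x) (s : Finset (Fin d → ℤ)) :
    polyAverage T p f s =ᵐ[μ] fun x => (∏ i, C i) * polyAverage T p g s x := by
  have h1 : ∀ (u : Fin d → ℤ) i, ∀ᵐ x ∂μ, f i (monomialMap T (fun j => p i j u) x) =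
      C i * g i (monomialMap T (fun j => p i j u) x) := fun u i =>
    (hT.measurePreserving_monomialMap _).quasiMeasurePreserving.ae_eq_comp (h i)
  have h2 : ∀ᵐ x ∂μ, ∀ u ∈ s, ∀ i, f i (monomialMap T (fun j => p i j u) x) =
      C i * g i (monomialMap T (fun j => p i j u) x) :=
    s.eventually_all.2 fun u _ => ae_all_iff.2 (h1 u)
  filter_upwards [h2] with x hx
  simp only [polyAverage]
  rw [mul_left_comm]
  refine congrArg _ ?_
  rw [Finset.mul_sum]
  refine Finset.sum_congr rfl fun u hu => ?_
  rw [← Finset.prod_mul_distrib]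
  exact Finset.prod_congr rfl fun i _ => hx u hu i

/-- Convergence is tested along every ultrafilter finer than `atTop`, where the limit is an
invariant mean of a correlation and control applies. The constants `C i` reduce the general case to
functions bounded by one. -/
lemma tendsto_eLpNorm_polyAverage [IsProbabilityMeasure μ] {T : Fin l → Equiv.Perm X} (hT : IsSystem μ T)
    {p : Fin r → Fin l → (Fin d → ℤ) → ℤ} {m : Fin r} {K : ℕ}
    (hK : Controlled.{u} K (doubledFamily p) (Sum.inl m)) {Q : ℕ → (X → ℝ) → ℝ}
    (hQ : IsUniformity μ (fun c : Fin l → ℤ => monomialMap T c) K Q) {f g : Fin r → X → ℝ}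
    {C : Fin r → ℝ} (hg : ∀ i, UnitBounded (g i)) (hfg : ∀ i, f i =ᵐ[μ] fun x => C i * g i x)
    (h0 : Q K (g m) = 0) {Φ : ℕ → Finset (Fin d → ℤ)} (hΦ : IsFolner Φ) :
    Tendsto (fun N => eLpNorm (polyAverage T p f (Φ N)) 2 μ) atTop (𝓝 0) := by
  have hτ := hT.isAction
  have hgg : ∀ x : Fin r ⊕ Fin r, UnitBounded (Sum.elim g g x) := by
    rintro (i | i) <;> exact hg i
  have hG : ∀ u : Fin d → ℤ, UnitBounded
      (fun x => ∏ i, g i (monomialMap T (fun j => p i j u) x)) := fun u =>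
    unitBounded_prod_action hτ hg fun i j => p i j u
  have hmem : ∀ N, MemLp (polyAverage T p g (Φ N)) 2 μ := fun N =>
    (memLp_finsetSum (Φ N) fun u _ => (hG u).memLp 2 μ).const_mul _
  have hlim : Tendsto (fun N => ∫ x, polyAverage T p g (Φ N) x ^ 2 ∂μ) atTop (𝓝 0) := by
    simp only [integral_sq_polyAverage hT p hg Φ]
    refine tendsto_iff_ultrafilter _ _ _ |>.2 fun U hU => ?_
    have h1 := tendsto_squareAverage_limUnder (Φ := Φ) U
      ⟨1, abs_correlation_le hτ (doubledFamily p) hgg⟩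
    have h2 := hK X μ _ Q hτ hQ (hΦ.invariantMean U hU) (Sum.elim g g) hgg h0
    change limUnder (U : Filter ℕ) _ = 0 at h2
    rwa [h2] at h1
  have h3 := tendsto_eLpNorm_of_tendsto_integral_sq hmem hlim
  have h4 : ∀ N, eLpNorm (polyAverage T p f (Φ N)) 2 μ =
      ‖∏ i, C i‖ₑ * eLpNorm (polyAverage T p g (Φ N)) 2 μ := fun N => by
    rw [eLpNorm_congr_ae (polyAverage_ae_eq hT p hfg (Φ N)), ← eLpNorm_const_smul]
    rfl
  simp only [h4]
  have h5 := ENNReal.Tendsto.const_mul (a := ‖∏ i, C i‖ₑ) h3 (Or.inr enorm_ne_top)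
  rwa [mul_zero] at h5

end Convergence

/-! ### Invariance of the Host–Kra factors -/

section Factors

variable {X : Type*} {𝒵 mX : MeasurableSpace X} {μ : Measure X}
  [IsProbabilityMeasure μ]

lemma measurable_cubeProd {X : Type*} [MeasurableSpace X] {f : X → ℝ} (hf : Measurable f) : ∀ k, Measurable (cubeProd f k)
  | 0 => hf
  | k + 1 => ((measurable_cubeProd hf k).comp measurable_fst).mul
      ((measurable_cubeProd hf k).comp measurable_snd)

/-- The diagonal map of `S` preserves the Host–Kra measures of `T`, because `S` commutes with `T`.
-/
lemma IsHostKraSeminorm.comp {T S : X → X} (hT : MeasurePreserving T μ μ)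
    (hS : MeasurePreserving S μ μ) (hTS : ∀ x, T (S x) = S (T x)) {k : ℕ} {f : X → ℝ} {s : ℝ}
    (hf : AEStronglyMeasurable f μ) (h : IsHostKraSeminorm μ T k f s) :
    IsHostKraSeminorm μ T k (fun x => f (S x)) s := by
  obtain ⟨hs, ν, hν, hsν⟩ := h
  refine ⟨hs, ν, hν, ?_⟩
  have hmp := (hν.measurePreserving_cubeMap hT hS hTS).2
  obtain ⟨f', hf', hff'⟩ := hf
  have hmeas : AEStronglyMeasurable (cubeProd f k) ν :=
    ⟨_, (measurable_cubeProd hf'.measurable k).stronglyMeasurable, hν.ae_eq_cubeProd hff'⟩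
  rw [hsν]
  simp only [← cubeProd_cubeMap]
  conv_lhs => rw [← hmp.map_eq]
  rw [integral_map hmp.measurable.aemeasurable (by rwa [hmp.map_eq])]

lemma IsHostKraFactor.condExp_comp_eq_zero {T : Equiv.Perm X} {S : X → X} {k : ℕ} (h𝒵 : IsHostKraFactor μ T k 𝒵) (hT : MeasurePreserving T μ μ)
    (hS : MeasurePreserving S μ μ) (hTS : ∀ x, T (S x) = S (T x)) {f : X → ℝ} (hf : MemLp f ∞ μ)
    (h : μ[f|𝒵] =ᵐ[μ] 0) : μ[fun x => f (S x)|𝒵] =ᵐ[μ] 0 :=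
  (h𝒵.condExp_eq_zero_iff _ (hf.comp_measurePreserving hS)).2
    (((h𝒵.condExp_eq_zero_iff f hf).1 h).comp hT hS hTS hf.1)

/-- Let `g` be the indicator of `S ⁻¹' A`, `e` its conditional expectation and `h = g - e`. The
kernel of the conditional expectation contains `h` and, by invariance, `h ∘ S⁻¹`. Hence `∫ h g = ∫_A
h ∘ S⁻¹ = 0` and `∫ h e = 0`, so `∫ h ^ 2 = 0` and `g = e` almost everywhere; `B` is the set where
`e = 1`. -/
lemma IsHostKraFactor.exists_preimage_ae_eq {T S : Equiv.Perm X} {k : ℕ} (h𝒵 : IsHostKraFactor μ T k 𝒵) (hT : MeasurePreserving T μ μ)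
    (hS : MeasurePreserving S μ μ) (hS' : Measurable S.symm) (hTS : Commute T S) {A : Set X}
    (hA : MeasurableSet[𝒵] A) : ∃ B, MeasurableSet[𝒵] B ∧ S ⁻¹' A =ᵐ[μ] B := by
  have hSs := measurePreserving_symm hS hS'
  have hcomm : ∀ x, T (S.symm x) = S.symm (T x) := fun x =>
    Equiv.ext_iff.1 (hTS.inv_right).eq x
  have hA' : MeasurableSet A := h𝒵.le _ hA
  set g : X → ℝ := (S ⁻¹' A).indicator fun _ => 1 with hg
  have hgL : MemLp g ∞ μ := memLp_indicator_const ∞ (hS.measurable hA') 1 (by simp)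
  set e : X → ℝ := μ[g|𝒵] with he
  have heL : MemLp e ∞ μ := hgL.condExp le_top
  have hgi := hgL.integrable le_top
  have hei := heL.integrable le_top
  set h : X → ℝ := fun x => g x - e x with hh
  have hhL : MemLp h ∞ μ := hgL.sub heL
  have hhi := hhL.integrable le_top
  have hh0 : μ[h|𝒵] =ᵐ[μ] 0 := by
    have h1 := condExp_sub hgi hei 𝒵
    rw [he, condExp_of_stronglyMeasurable h𝒵.le stronglyMeasurable_condExp integrable_condExp,
      sub_self] at h1
    exact h1
  have h1 : ∫ x, h x * g x ∂μ = 0 := by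
    have h2 := h𝒵.condExp_comp_eq_zero hT hSs hcomm hhL hh0
    have hhS : Integrable (fun x => h (S.symm x)) μ :=
      (hhL.comp_measurePreserving hSs).integrable le_top
    have h3 : ∫ x in A, h (S.symm x) ∂μ = 0 := by
      rw [← setIntegral_condExp h𝒵.le hhS hA, setIntegral_congr_ae hA' (h2.mono fun x hx _ => hx)]
      simp
    have h4 := hS.integral_comp (⟨S, hS.measurable, hS'⟩ : X ≃ᵐ X).measurableEmbedding
      (A.indicator fun x => h (S.symm x))
    rw [← h3, ← integral_indicator hA', ← h4]
    congr 1
    ext x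
    by_cases hx : S x ∈ A <;> simp [hg, hx]
  have h2 : ∫ x, h x * e x ∂μ = 0 := by
    have h3 := condExp_mul_of_stronglyMeasurable_right (μ := μ) (m := 𝒵) (f := h) (g := e)
      stronglyMeasurable_condExp ((heL.mul hhL (r := ∞)).integrable le_top) hhi
    have h4 := integral_condExp (μ := μ) (f := h * e) h𝒵.le
    rw [integral_congr_ae h3] at h4
    have h5 : ∫ x, (μ[h|𝒵] * e) x ∂μ = 0 := by
      rw [integral_congr_ae (g := fun _ => (0 : ℝ)) (hh0.mono fun x hx => by simp [hx])]
      simp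
    exact h4.symm.trans h5
  have hge : g =ᵐ[μ] e := by
    have h3 : ∫ x, h x ^ 2 ∂μ = 0 := by
      have : ∀ x, h x ^ 2 = h x * g x - h x * e x := fun x => by simp only [hh]; ring
      simp only [this]
      refine (integral_sub ((hgL.mul hhL (r := ∞)).integrable le_top)
        ((heL.mul hhL (r := ∞)).integrable le_top)).trans ?_
      simp only [Pi.mul_apply, h1, h2, sub_zero]
    have hsq : Integrable (fun x => h x ^ 2) μ :=
      ((hhL.mul hhL (r := ∞)).integrable le_top).congr (ae_of_all _ fun x => (sq (h x)).symm)
    have h4 := (integral_eq_zero_iff_of_nonneg (fun x => sq_nonneg (h x)) hsq).1 h3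
    filter_upwards [h4] with x hx
    have : h x = 0 := by simpa using hx
    exact sub_eq_zero.1 this
  refine ⟨e ⁻¹' {1}, stronglyMeasurable_condExp.measurable (measurableSet_singleton 1), ?_⟩
  filter_upwards [hge] with x hx
  refine propext (?_ : S x ∈ A ↔ e x = 1)
  rw [← hx]
  by_cases hxA : S x ∈ A <;> simp [hg, hxA]

lemma IsHostKraFactor.isInvariantSigmaAlgebra {T S : Equiv.Perm X} {k : ℕ} (h𝒵 : IsHostKraFactor μ T k 𝒵) (hT : MeasurePreserving T μ μ)
    (hS : MeasurePreserving S μ μ) (hS' : Measurable S.symm) (hTS : Commute T S) :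
    IsInvariantSigmaAlgebra μ S 𝒵 := fun _ hA =>
  ⟨h𝒵.exists_preimage_ae_eq hT hS hS' hTS hA,
    h𝒵.exists_preimage_ae_eq hT (measurePreserving_symm hS hS') hS.measurable hTS.inv_right hA⟩

lemma IsHostKraFactor.isCharacteristicFactor {d r l : ℕ} {T : Fin l → Equiv.Perm X}
    (hT : IsSystem μ T) {j : Fin l} {k : ℕ} (h𝒵 : IsHostKraFactor μ (T j) k 𝒵)
    {p : Fin r → Fin l → (Fin d → ℤ) → ℤ}
    (h : ∀ f : Fin r → X → ℝ, (∀ i, MemLp (f i) ∞ μ) →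
      (∃ (m : Fin r) (j : Fin l), IsHostKraSeminorm μ (T j) (k + 1) (f m) 0) →
        ∀ Φ : ℕ → Finset (Fin d → ℤ), IsFolner Φ →
          Tendsto (fun N => eLpNorm (polyAverage T p f (Φ N)) 2 μ) atTop (𝓝 0)) :
    IsCharacteristicFactor μ T p 𝒵 where
  le := h𝒵.le
  invariant i := h𝒵.isInvariantSigmaAlgebra (hT.measurePreserving j) (hT.measurePreserving i)
    (hT.measurable_symm i) (hT.commute j i)
  tendsto f hf hcond := by
    obtain ⟨m, hm⟩ := hcond
    exact h f hf ⟨m, j, (h𝒵.condExp_eq_zero_iff (f m) (hf m)).1 hm⟩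

end Factors

end PolyErgodic

/-! ### The theorem -/

theorem propositionR {d r l : ℕ} (p : Fin r → Fin l → (Fin d → ℤ) → ℤ) (hp : IsEDSet p) :
    ∃ n : ℕ, ∀ (X : Type*) [MeasurableSpace X] (μ : Measure X) [IsProbabilityMeasure μ]
      (T : Fin l → Equiv.Perm X), IsFreelyGeneratedTotallyErgodic μ T →
        (∀ f : Fin r → X → ℝ, (∀ i, MemLp (f i) ∞ μ) →
          (∃ (m : Fin r) (j : Fin l), IsHostKraSeminorm μ (T j) (n + 1) (f m) 0) →
            ∀ Φ : ℕ → Finset (Fin d → ℤ), IsFolner Φ →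
              Tendsto (fun N => eLpNorm (polyAverage T p f (Φ N)) 2 μ) atTop (𝓝 0)) ∧
        ∀ (j : Fin l) (𝒵 : MeasurableSpace X), IsHostKraFactor μ (T j) n 𝒵 →
          IsCharacteristicFactor μ T p 𝒵 := by
  have hcontrol : ∀ m : Fin r, ∃ K, Controlled K (doubledFamily p) (Sum.inl m) := fun m =>
    have : Nontrivial (Fin r ⊕ Fin r) := ⟨Sum.inl m, Sum.inr m, Sum.inl_ne_inr⟩
    exists_controlled (exists_doubledFamily_mem_polyLT hp.isIntPolynomial)
      (hp.doubledFamily_sub_notMem m)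
  choose K hK using hcontrol
  -- One order for all `m`. The factor of index `n` corresponds to the seminorm of order `n + 1`, so
  -- `K m ≤ n + 1` is what is needed.
  refine ⟨Finset.univ.sup K, fun X _ μ _ T hT => ?_⟩
  have hconv : ∀ f : Fin r → X → ℝ, (∀ i, MemLp (f i) ∞ μ) →
      (∃ (m : Fin r) (j : Fin l), IsHostKraSeminorm μ (T j) (Finset.univ.sup K + 1) (f m) 0) →
        ∀ Φ : ℕ → Finset (Fin d → ℤ), IsFolner Φ →
          Tendsto (fun N => eLpNorm (polyAverage T p f (Φ N)) 2 μ) atTop (𝓝 0) := by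
    rintro f hf ⟨m, j, -, ν, hν, h0⟩ Φ hΦ
    choose C g hC hg hfg using fun i => exists_unitBounded (hf i)
    refine tendsto_eLpNorm_polyAverage hT.toIsSystem
      ((hK m).mono ((Finset.le_sup (Finset.mem_univ m)).trans (Nat.le_succ _)))
      (hT.isUniformity hν) hg hfg ?_ hΦ
    -- The seminorm is homogeneous and does not see null sets, so it vanishes for the normalised
    -- function `g m` as well.
    rw [zero_pow (by positivity), integral_congr_ae (hν.ae_eq_cubeProd (hfg m))] at h0
    simp only [cubeProd_const_mul, integral_const_mul] at h0
    rw [hostKraFunctional, (isHostKraMeasure_hostKraMeasure hν le_rfl).unique hν]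
    exact (mul_eq_zero.1 h0.symm).resolve_left (pow_ne_zero _ (hC m).ne')
  have hsys := hT.toIsSystem
  exact ⟨hconv, fun j 𝒵 h𝒵 => h𝒵.isCharacteristicFactor hsys hconv⟩
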